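/- Let $\gamma>-3$, $s\in(0,1)$, and let $\tilde b:[-1,1]\to(0,\infty)$ be bounded (and measurable). Consider the non-cutoff Boltzmann equation \[ \partial_t f+v\cdot\nabla_x f=Q(f,f),\qquad Q(f,f)(t,x,v)=\int_{\mathbb R^3}\int_{\mathbb S^2}B(v-v_*,\sigma)\bigl(f(t,x,v_*')f(t,x,v')-f(t,x,v_*)f(t,x,v)\bigr)\,d\sigma\,dv_*, \] where $v'=\frac{v+v_*}2+\sigma\frac{|v-v_*|}2$, $v_*'=\frac{v+v_*}2-\sigma\frac{|v-v_*|}2$, and $B(v-v_*,\sigma)=|v-v_*|^\gamma\theta^{-2-2s}\tilde b(\cos\theta)$ with $\theta\in[0,\pi]$, $\cos\theta=\sigma\cdot\frac{v-v_*}{|v-v_*|}$. The integral is understood in the principal value sense at the singularity $\theta=0$: the integrals over $\{\theta>\varepsilon\}$ converge absolutely and $Q(f,f)$ is their limit as $\varepsilon\to0^+$. A (classical) solution on $[0,T]\times\mathbb R^3\times\mathbb R^3$, $T>0$, is a continuous function $f\ge0$ that is $C^1$ in $(t,x)$ and $C^2$ in $v$ and satisfies the equation at every point. Let $K_0,P_0\in\mathbb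 R$ and, if $\gamma+2s<0$, let $p\in\bigl(\frac{3}{3+\gamma+2s},\infty\bigr]$. Write $\langle a\rangle=\sqrt{1+|a|^2}$ and $a_+=\max\{a,0\}$. There is a constant $C>0$, depending only on $\gamma$, $s$, $\tilde b$, $K_0$ (and, only if $\gamma+2s<0$, on $p$ and $P_0$), such that the following holds. Let $T>0$, $\tau>0$, and let $f$ be a solution on $[0,T]\times\mathbb R^3\times\mathbb R^3$ such that, for all $t\in[0,T]$ and $x\in\mathbb R^3$, \[ \int_{\mathbb R^3}\bigl(1+|v|^{\max\{2,\gamma+2s\}}\bigr)f(t,x,v)\,dv\le K_0,\qquad\text{and, if }\gamma+2s<0,\quad \|f(t,x,\cdot)\|_{L^p(\mathbb R^3)}\le P_0 . \] Let $(x_0,v_0)\in\mathbb R^3\times\mathbb R^3$ and $\delta,r>0$ be such that $f(0,x,v)\ge\delta$ whenever $|x-x_0|<r$ and $|v-v_0|<r/\tau$. Then \[ f(t,x,v)\ge\frac\delta2 \] for all $t$ with $0\le t\le\min\{T,\tau\}$ and all $x,v\in\mathbb R^3$ such that \[ \frac{|v-v_0|^2}{r^2/\tau^2}+\frac{|x-x_0-tv|^2}{r^2}<\frac14\qquad\text{and}\qquad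 t<\frac{C\,r^{2s}}{\tau^{2s}\,\langle|v_0|+r/\tau\rangle^{(\gamma+2s)_+}} . \] -/

import Mathlib

open MeasureTheory Set Filter Topology

noncomputable section

/-- Euclidean space `ℝ³`. -/
abbrev R3 : Type := EuclideanSpace ℝ (Fin 3)

/-- The unit sphere `𝕊²`. It carries the surface measure `volume.toSphere`. -/
abbrev S2 : Type := Metric.sphere (0 : R3) 1

/-- The velocity `v' = (v + v_*)/2 + σ |v - v_*|/2`. -/
def vPrime (v vs : R3) (σ : S2) : R3 :=
  (1 / 2 : ℝ) • (v + vs) + (‖v - vs‖ / 2) • (σ : R3)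

/-- The velocity `v_*' = (v + v_*)/2 - σ |v - v_*|/2`. -/
def vsPrime (v vs : R3) (σ : S2) : R3 :=
  (1 / 2 : ℝ) • (v + vs) - (‖v - vs‖ / 2) • (σ : R3)

/-- The deviation angle `θ ∈ [0, π]`, with `cos θ = σ · (v - v_*) / |v - v_*|`. -/
def deviationAngle (v vs : R3) (σ : S2) : ℝ :=
  InnerProductGeometry.angle (v - vs) (σ : R3)

/-- The non-cutoff kernel `B(v - v_*, σ) = |v - v_*| ^ γ θ ^ (-2 - 2s) b(cos θ)`. -/
def collisionKernel (γ s : ℝ) (b : ℝ → ℝ) (v vs : R3) (σ : S2) : ℝ :=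
  ‖v - vs‖ ^ γ * deviationAngle v vs σ ^ (-2 - 2 * s) * b (Real.cos (deviationAngle v vs σ))

/-- The integrand `B(v - v_*, σ) (g(v_*') g(v') - g(v_*) g(v))` of `Q(g, g)(v)`, as a function
of `(v_*, σ)`. -/
def collisionIntegrand (γ s : ℝ) (b : ℝ → ℝ) (g : R3 → ℝ) (v : R3) (q : R3 × S2) : ℝ :=
  collisionKernel γ s b v q.1 q.2 *
    (g (vsPrime v q.1 q.2) * g (vPrime v q.1 q.2) - g q.1 * g v)

/-- The non-grazing collisions `θ > ε`. -/
def nonGrazing (v : R3) (ε : ℝ) : Set (R3 × S2) :=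
  {q | ε < deviationAngle v q.1 q.2}

/-- `Q(g, g)(v)` exists and equals `Q`. The integral over `(v_*, σ) ∈ ℝ³ × 𝕊²` is taken in the
principal value sense at the singularity `θ = 0`: the integrals over `θ > ε` converge absolutely
and tend to `Q` as `ε → 0+`. If the whole integral converges absolutely, this is its value. -/
def HasCollisionValue (γ s : ℝ) (b : ℝ → ℝ) (g : R3 → ℝ) (v : R3) (Q : ℝ) : Prop :=
  (∀ ε : ℝ, 0 < ε → IntegrableOn (collisionIntegrand γ s b g v) (nonGrazing v ε)
      ((volume : Measure R3).prod (volume : Measure R3).toSphere)) ∧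
    Tendsto (fun ε : ℝ => ∫ q in nonGrazing v ε, collisionIntegrand γ s b g v q
      ∂((volume : Measure R3).prod (volume : Measure R3).toSphere)) (𝓝[>] 0) (𝓝 Q)

/-- The angular function `b` of the kernel is a (measurable) positive bounded function of
`cos θ ∈ [-1, 1]`. -/
structure IsAngularFunction (b : ℝ → ℝ) : Prop where
  measurable : Measurable b
  pos : ∀ c ∈ Icc (-1 : ℝ) 1, 0 < b c
  bounded : ∃ M : ℝ, ∀ c ∈ Icc (-1 : ℝ) 1, b c ≤ M

/-- `f = f(t, x, v)` is a classical solution of the Boltzmann equation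
`∂_t f + v · ∇_x f = Q(f, f)` on `[0, T] × ℝ³ × ℝ³`: nonnegative, continuous, `C¹` in `(t, x)`,
`C²` in `v`, and the equation holds at every point (with one-sided time derivatives at the
endpoints of `[0, T]`). -/
structure IsClassicalSolution (γ s : ℝ) (b : ℝ → ℝ) (T : ℝ) (f : ℝ → R3 → R3 → ℝ) : Prop where
  nonneg : ∀ t ∈ Icc 0 T, ∀ x v, 0 ≤ f t x v
  continuousOn : ContinuousOn (fun p : ℝ × R3 × R3 => f p.1 p.2.1 p.2.2) (Icc 0 T ×ˢ univ)
  contDiffOn_tx : ∀ v, ContDiffOn ℝ 1 (fun p : ℝ × R3 => f p.1 p.2 v) (Icc 0 T ×ˢ univ)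
  contDiff_v : ∀ t ∈ Icc 0 T, ∀ x, ContDiff ℝ 2 (fun v => f t x v)
  equation : ∀ t ∈ Icc 0 T, ∀ x v,
    HasCollisionValue γ s b (f t x) v
      (derivWithin (fun t' => f t' x v) (Icc 0 T) t + fderiv ℝ (fun x' => f t x' v) x v)

/-- The zeroth-order bounds: `∫ (1 + |v| ^ max {2, γ + 2s}) f(t, x, v) dv ≤ K₀` and, only if
`γ + 2s < 0`, also `‖f(t, x, ·)‖_{L^p} ≤ P₀`, for all `t ∈ [0, T]` and `x ∈ ℝ³`. -/
structure HydroBounds (γ s K₀ : ℝ) (p : ENNReal) (P₀ T : ℝ) (f : ℝ → R3 → R3 → ℝ) : Prop where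
  integrable : ∀ t ∈ Icc 0 T, ∀ x,
    Integrable (fun v : R3 => (1 + ‖v‖ ^ max 2 (γ + 2 * s)) * f t x v)
  moment_le : ∀ t ∈ Icc 0 T, ∀ x,
    ∫ v : R3, (1 + ‖v‖ ^ max 2 (γ + 2 * s)) * f t x v ≤ K₀
  eLpNorm_le : γ + 2 * s < 0 → ∀ t ∈ Icc 0 T, ∀ x,
    eLpNorm (f t x) p volume ≤ ENNReal.ofReal P₀

/-- The bracket `⟨a⟩ = √(1 + |a|²)` of a scalar. -/
def bracket (a : ℝ) : ℝ := Real.sqrt (1 + |a| ^ 2)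

end

/-! The proof compares `f` with an explicit barrier. Put `ρ = r / τ` and let the barrier be `δ (1 -
|v - v₀|²/ρ² - |x - x₀ - t v|²/r² - l t)`. It depends on `x` only through `x - t v`, so its
transport derivative is exactly `-δ l`. It is nonpositive outside a compact set of `(t, x, v)`,
where `f ≥ 0` dominates it. If `f` fell below it somewhere, `f - barrier` would attain a negative
global minimum at some positive time, and there the transport derivative of `f` would be at most `-δ
l` (`IsClassicalSolution.transport_le`). The contradiction comes from a bound `Q(f, f) > -δ l` at
every such touching point (`collision_ge`).

For that bound, split the integrand as `f(v_*') (f(v') - f(v)) + f(v) (f(v_*') - f(v_*))`. The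
exchange `σ ↦ -σ` first folds the kernel to `θ ≤ π/2`, keeping `cos(θ/2)` away from zero. The second
term then integrates to something nonnegative: passing from `v_*` to `v_*'` produces the Jacobian
`cos(θ/2)^(-3-γ) ≥ 1` (`integrable_loss_gain`). In the first term, exchanging `σ` with the direction
of `v - v_*` fixes `θ` and `v_*'` and reflects `v'` through `v`, so only second differences of `f`
at `v` matter. These are at least `-2δ min(B |h|², 1)` with `B = 2/ρ²`: for small `h` because a
translate of the barrier touches from below, for large `h` because `f ≥ 0` and `f(v) ≤ δ`. In
Carleman's variable `y = v - v_*'` the angular integral of this weight is of order `(B |y|²)^s`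
(`lintegral_singular_le`), which leaves `δ B^s ∫ |y|^(γ+2s) f(v - y) dy`. The moment and `L^p`
hypotheses control that convolution (`exists_lintegral_rpow_mul_le`). All constants are independent
of the angular cutoff, so the bound survives the principal value limit. -/

/-! ### Rotations of the sphere and polar coordinates. -/

/-- The surface measure on the unit sphere. -/
noncomputable abbrev sphereMeasure : Measure S2 := (volume : Measure R3).toSphere

/-- The action of a linear isometry on the unit sphere. -/
noncomputable def sphereMap (L : R3 ≃ₗᵢ[ℝ] R3) (ω : S2) : S2 :=
  ⟨L ω, by simp⟩

theorem continuous_sphereMap (L : R3 ≃ₗᵢ[ℝ] R3) : Continuous (sphereMap L) :=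
  (L.continuous.comp continuous_subtype_val).subtype_mk _

-- The surface measure of a set is three times the volume of the cone over it, and a linear isometry
-- maps cones to cones and preserves volume.
open scoped Pointwise in
theorem measurePreserving_sphereMap (L : R3 ≃ₗᵢ[ℝ] R3) :
    MeasurePreserving (sphereMap L) sphereMeasure sphereMeasure := by
  refine ⟨(continuous_sphereMap L).measurable, ?_⟩
  ext s hs
  rw [Measure.map_apply (continuous_sphereMap L).measurable hs, Measure.toSphere_apply' _ hs,
    Measure.toSphere_apply' _ ((continuous_sphereMap L).measurable hs)]
  congr 1
  have h := (L.measurePreserving).measure_preimage_emb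
    L.toHomeomorph.measurableEmbedding (Ioo (0 : ℝ) 1 • ((↑) '' s : Set R3))
  rw [← h]
  congr 1
  ext x
  simp only [Set.mem_smul, mem_preimage]
  constructor
  · rintro ⟨c, hc, y, ⟨ω, hω, rfl⟩, rfl⟩
    exact ⟨c, hc, _, ⟨_, hω, rfl⟩, by simp [sphereMap]⟩
  · rintro ⟨c, hc, y, ⟨ω, hω, rfl⟩, h⟩
    refine ⟨c, hc, _, ⟨sphereMap L.symm ω, ?_, rfl⟩, ?_⟩
    · have : sphereMap L (sphereMap L.symm ω) = ω := by
        ext1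
        simp [sphereMap]
      simpa only [mem_preimage, this] using hω
    · apply L.injective
      simp [sphereMap, ← h]

/-- The radial measure `t² dt` on `(0, ∞)`. -/
noncomputable abbrev radialMeasure : Measure (Ioi (0 : ℝ)) := Measure.volumeIoiPow 2

theorem measurePreserving_polar :
    MeasurePreserving (fun q : S2 × Ioi (0 : ℝ) => (q.2 : ℝ) • (q.1 : R3))
      (sphereMeasure.prod radialMeasure) volume := by
  have h := (volume : Measure R3).measurePreserving_homeomorphUnitSphereProd
  have hd : Module.finrank ℝ R3 - 1 = 2 := by simp
  rw [hd] at h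
  have h' := h.symm (homeomorphUnitSphereProd R3).toMeasurableEquiv
  have h2 : MeasurePreserving (Subtype.val : ({0}ᶜ : Set R3) → R3)
      ((volume : Measure R3).comap (↑)) volume := by
    refine ⟨measurable_subtype_coe, ?_⟩
    rw [map_comap_subtype_coe (measurableSet_singleton _).compl, restrict_compl_singleton]
  exact h2.comp h'

theorem measurePreserving_flip :
    MeasurePreserving (fun q : (S2 × S2) × Ioi (0 : ℝ) => ((q.1.1, -q.1.2), q.2))
      ((sphereMeasure.prod sphereMeasure).prod radialMeasure)
      ((sphereMeasure.prod sphereMeasure).prod radialMeasure) := by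
  have h := measurePreserving_sphereMap (LinearIsometryEquiv.neg ℝ)
  have h1 : sphereMap (LinearIsometryEquiv.neg ℝ) = fun ω => -ω := by
    ext1 ω; ext1; simp [sphereMap]
  rw [h1] at h
  exact ((MeasurePreserving.id _).prod h).prod (MeasurePreserving.id _)

theorem measurePreserving_swapSpheres :
    MeasurePreserving (fun q : (S2 × S2) × Ioi (0 : ℝ) => ((q.1.2, q.1.1), q.2))
      ((sphereMeasure.prod sphereMeasure).prod radialMeasure)
      ((sphereMeasure.prod sphereMeasure).prod radialMeasure) :=
  (Measure.measurePreserving_swap).prod (MeasurePreserving.id _)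

theorem measurePreserving_collisionPolar (v : R3) :
    MeasurePreserving (fun q : (S2 × S2) × Ioi (0 : ℝ) => (v - (q.2 : ℝ) • (q.1.1 : R3), q.1.2))
      ((sphereMeasure.prod sphereMeasure).prod radialMeasure)
      ((volume : Measure R3).prod sphereMeasure) := by
  have h1 := (Measure.measurePreserving_sub_left (volume : Measure R3) v).comp
    measurePreserving_polar
  have h2 := h1.prod (MeasurePreserving.id sphereMeasure)
  have h3 : MeasurePreserving (fun q : (S2 × S2) × Ioi (0 : ℝ) => ((q.1.1, q.2), q.1.2))
      ((sphereMeasure.prod sphereMeasure).prod radialMeasure)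
      ((sphereMeasure.prod radialMeasure).prod sphereMeasure) := by
    have e1 := measurePreserving_prodAssoc sphereMeasure sphereMeasure radialMeasure
    have e2 := (MeasurePreserving.id sphereMeasure).prod
      (Measure.measurePreserving_swap (μ := sphereMeasure) (ν := radialMeasure))
    have e3 := (measurePreserving_prodAssoc sphereMeasure radialMeasure sphereMeasure).symm
    exact e3.comp (e2.comp e1)
  exact h2.comp h3

/-! ### Rotation-invariant measures on the sphere. -/

theorem exists_linearIsometryEquiv_eq {x y : R3} (h : ‖x‖ = ‖y‖) :
    ∃ L : R3 ≃ₗᵢ[ℝ] R3, L x = y :=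
  ⟨_, Submodule.reflection_sub h⟩

theorem charFun_eq_of_norm_eq {ν : Measure R3} (hν : ∀ L : R3 ≃ₗᵢ[ℝ] R3, ν.map L = ν)
    {x y : R3} (h : ‖x‖ = ‖y‖) : charFun ν x = charFun ν y := by
  obtain ⟨L, rfl⟩ := exists_linearIsometryEquiv_eq h
  conv_rhs => rw [← hν L]
  rw [charFun_apply, charFun_apply, integral_map L.continuous.aemeasurable
    (by fun_prop)]
  simp

/-- By invariance the characteristic function is radial, so the integrand is constant on unit
vectors. -/
theorem integral_charFun_smul {ν₁ ν₂ : Measure R3} [IsFiniteMeasure ν₂]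
    (h₁ : ∀ L : R3 ≃ₗᵢ[ℝ] R3, ν₁.map L = ν₁) (h₂ : ∀ᵐ x ∂ν₂, ‖x‖ = 1) (ξ : R3) :
    ∫ y, charFun ν₁ (‖ξ‖ • y) ∂ν₂ = ν₂.real univ * charFun ν₁ ξ := by
  have : ∀ᵐ y ∂ν₂, charFun ν₁ (‖ξ‖ • y) = charFun ν₁ ξ := by
    filter_upwards [h₂] with y hy
    exact charFun_eq_of_norm_eq h₁ (by simp [norm_smul, hy])
  rw [integral_congr_ae this]
  simp

/-- Both sides are the integral of `exp(i |ξ| ⟨x, y⟩)` against the product of the two measures,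
evaluated in the two orders. -/
theorem charFun_mul_eq_of_invariant {ν₁ ν₂ : Measure R3} [IsFiniteMeasure ν₁] [IsFiniteMeasure ν₂]
    (h₁ : ∀ L : R3 ≃ₗᵢ[ℝ] R3, ν₁.map L = ν₁) (h₁' : ∀ᵐ x ∂ν₁, ‖x‖ = 1)
    (h₂ : ∀ L : R3 ≃ₗᵢ[ℝ] R3, ν₂.map L = ν₂) (h₂' : ∀ᵐ x ∂ν₂, ‖x‖ = 1) (ξ : R3) :
    ν₂.real univ * charFun ν₁ ξ = ν₁.real univ * charFun ν₂ ξ := by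
  rw [← integral_charFun_smul h₁ h₂', ← integral_charFun_smul h₂ h₁']
  simp only [charFun_apply]
  rw [integral_integral_swap]
  · simp only [inner_smul_right, real_inner_comm]
  · refine Integrable.of_bound (C := 1) (by fun_prop) (Eventually.of_forall fun p => ?_)
    simp [Function.uncurry, Complex.norm_exp_ofReal_mul_I]

/-- Finite rotation invariant measures on the unit sphere are proportional. -/
theorem smul_eq_smul_of_invariant {ν₁ ν₂ : Measure R3} [IsFiniteMeasure ν₁] [IsFiniteMeasure ν₂]
    (h₁ : ∀ L : R3 ≃ₗᵢ[ℝ] R3, ν₁.map L = ν₁) (h₁' : ∀ᵐ x ∂ν₁, ‖x‖ = 1)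
    (h₂ : ∀ L : R3 ≃ₗᵢ[ℝ] R3, ν₂.map L = ν₂) (h₂' : ∀ᵐ x ∂ν₂, ‖x‖ = 1) :
    ν₂ univ • ν₁ = ν₁ univ • ν₂ := by
  have f₁ : IsFiniteMeasure (ν₂ univ • ν₁) := ν₁.smul_finite (measure_ne_top _ _)
  have f₂ : IsFiniteMeasure (ν₁ univ • ν₂) := ν₂.smul_finite (measure_ne_top _ _)
  refine Measure.ext_of_charFun (funext fun ξ => ?_)
  have := charFun_mul_eq_of_invariant h₁ h₁' h₂ h₂' ξ
  simpa [charFun_apply, Measure.real] using this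

/-- A rotation invariant weight on pairs of unit vectors distributes any equivariant unit vector
uniformly over the sphere. -/
theorem lintegral_equivariant {k : ℝ → ENNReal} (hk : Measurable k)
    (hfin : ∫⁻ p : S2 × S2, k (inner ℝ (p.1 : R3) p.2) ∂(sphereMeasure.prod sphereMeasure) ≠ ⊤)
    {m : R3 × R3 → R3} (hm : Measurable m)
    (hequi : ∀ (L : R3 ≃ₗᵢ[ℝ] R3) x y, m (L x, L y) = L (m (x, y)))
    (hunit : ∀ ω σ : S2, k (inner ℝ (ω : R3) σ) ≠ 0 → ‖m (ω, σ)‖ = 1)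
    {G : R3 → ENNReal} (hG : Measurable G) :
    sphereMeasure univ * ∫⁻ p : S2 × S2, k (inner ℝ (p.1 : R3) p.2) * G (m (p.1, p.2))
        ∂(sphereMeasure.prod sphereMeasure) =
      (∫⁻ p : S2 × S2, k (inner ℝ (p.1 : R3) p.2) ∂(sphereMeasure.prod sphereMeasure)) *
        ∫⁻ ω : S2, G ω ∂sphereMeasure := by
  set κ : S2 × S2 → ENNReal := fun p => k (inner ℝ (p.1 : R3) p.2) with hκ
  set M : S2 × S2 → R3 := fun p => m (p.1, p.2) with hM
  have hκm : Measurable κ := by fun_prop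
  have hMm : Measurable M := by fun_prop
  set π : Measure (S2 × S2) := (sphereMeasure.prod sphereMeasure).withDensity κ with hπ
  have : IsFiniteMeasure π := isFiniteMeasure_withDensity hfin
  have hval : Measurable (Subtype.val : S2 → R3) := measurable_subtype_coe
  -- The law of `m` under the weighted pair measure is invariant, because the weight sees only the
  -- inner product and `m` is equivariant; hence it is proportional to the surface measure.
  have key := smul_eq_smul_of_invariant (ν₁ := π.map M) (ν₂ := sphereMeasure.map Subtype.val)
    ?_ ?_ ?_ ?_
  · have h := congrArg (fun ν : Measure R3 => ∫⁻ x, G x ∂ν) key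
    simp only [lintegral_smul_measure, lintegral_map hG hMm, lintegral_map hG hval,
      Measure.map_apply hval .univ, Measure.map_apply hMm .univ, preimage_univ, smul_eq_mul] at h
    rw [hπ, lintegral_withDensity_eq_lintegral_mul _ hκm (by fun_prop)] at h
    rw [withDensity_apply _ .univ, setLIntegral_univ] at h
    simpa using h
  · intro L
    ext s hs
    have hLm : Measurable L := L.continuous.measurable
    rw [Measure.map_apply hLm hs, Measure.map_apply hMm (hLm hs), Measure.map_apply hMm hs,
      hπ, withDensity_apply _ (hMm (hLm hs)), withDensity_apply _ (hMm hs),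
      ← lintegral_indicator (hMm (hLm hs)), ← lintegral_indicator (hMm hs),
      ← ((measurePreserving_sphereMap L).prod (measurePreserving_sphereMap L)).lintegral_comp
        (hκm.indicator (hMm hs))]
    refine lintegral_congr fun p => ?_
    have e1 : M (Prod.map (sphereMap L) (sphereMap L) p) = L (M p) := by
      simp [hM, sphereMap, hequi]
    have e2 : κ (Prod.map (sphereMap L) (sphereMap L) p) = κ p := by
      simp [hκ, sphereMap]
    have e3 : Prod.map (sphereMap L) (sphereMap L) p ∈ M ⁻¹' s ↔ p ∈ M ⁻¹' (L ⁻¹' s) := by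
      rw [mem_preimage, e1]
      rfl
    by_cases hp : p ∈ M ⁻¹' (L ⁻¹' s)
    · rw [indicator_of_mem hp, indicator_of_mem (e3.2 hp), e2]
    · rw [indicator_of_notMem hp, indicator_of_notMem (mt e3.1 hp)]
  · rw [ae_map_iff hMm.aemeasurable (measurableSet_eq_fun measurable_norm measurable_const),
      hπ, ae_withDensity_iff hκm]
    exact Eventually.of_forall fun p hp => hunit _ _ hp
  · intro L
    have hLm : Measurable L := L.continuous.measurable
    rw [Measure.map_map hLm hval]
    conv_rhs => rw [← (measurePreserving_sphereMap L).map_eq,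
      Measure.map_map hval (continuous_sphereMap L).measurable]
    rfl
  · rw [ae_map_iff hval.aemeasurable (measurableSet_eq_fun measurable_norm measurable_const)]
    exact Eventually.of_forall fun p => by simp

/-! ### Radial scaling and Carleman's change of variables. -/

theorem lintegral_radialMeasure {g : ℝ → ENNReal} (hg : Measurable g) :
    ∫⁻ t : Ioi (0 : ℝ), g t ∂radialMeasure = ∫⁻ t in Ioi (0 : ℝ), ENNReal.ofReal (t ^ 2) * g t := by
  rw [radialMeasure, Measure.volumeIoiPow, lintegral_withDensity_eq_lintegral_mul _
    (by fun_prop) (by fun_prop)]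
  exact lintegral_subtype_comap measurableSet_Ioi fun t => ENNReal.ofReal (t ^ 2) * g t

theorem lintegral_radialMeasure_comp_mul {g : ℝ → ENNReal} (hg : Measurable g) {c : ℝ}
    (hc : 0 < c) :
    ∫⁻ t : Ioi (0 : ℝ), g (c * t) ∂radialMeasure =
      ENNReal.ofReal (c ^ 3)⁻¹ * ∫⁻ t : Ioi (0 : ℝ), g t ∂radialMeasure := by
  rw [lintegral_radialMeasure (g := fun t => g (c * t)) (by fun_prop), lintegral_radialMeasure hg,
    ← lintegral_indicator measurableSet_Ioi, ← lintegral_indicator measurableSet_Ioi]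
  conv_rhs => rw [← Real.smul_map_volume_mul_left hc.ne']
  rw [lintegral_smul_measure, lintegral_map (by measurability) (by fun_prop), smul_eq_mul,
    ← mul_assoc, ← ENNReal.ofReal_mul (by positivity), ← lintegral_const_mul _ (by measurability)]
  refine lintegral_congr fun t => ?_
  have hiff : c * t ∈ Ioi (0 : ℝ) ↔ t ∈ Ioi (0 : ℝ) := by simp [hc]
  by_cases ht : t ∈ Ioi (0 : ℝ)
  · rw [indicator_of_mem ht, indicator_of_mem (hiff.2 ht), ← mul_assoc,
      ← ENNReal.ofReal_mul (by positivity)]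
    congr 2
    rw [abs_of_pos hc]
    field_simp
  · rw [indicator_of_notMem ht, indicator_of_notMem (mt hiff.1 ht), mul_zero]

theorem lintegral_polar {G : R3 → ENNReal} (hG : Measurable G) :
    ∫⁻ y, G y = ∫⁻ t : Ioi (0 : ℝ), ∫⁻ ω : S2, G ((t : ℝ) • (ω : R3)) ∂sphereMeasure
      ∂radialMeasure := by
  rw [← measurePreserving_polar.lintegral_comp hG, lintegral_prod_symm' _ (by fun_prop)]

/-- `cos (θ / 2)` as a function of `cos θ`. -/
noncomputable def cosHalf (x : ℝ) : ℝ := Real.sqrt ((1 + x) / 2)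

theorem measurable_cosHalf : Measurable cosHalf := by unfold cosHalf; fun_prop

theorem norm_add_eq_cosHalf (ω σ : S2) : ‖(ω : R3) + σ‖ = 2 * cosHalf (inner ℝ (ω : R3) σ) := by
  have h : ‖(ω : R3) + σ‖ ^ 2 = 2 + 2 * inner ℝ (ω : R3) σ := by
    rw [norm_add_sq_real]; simp; ring
  have h2 : (2 : ℝ) = Real.sqrt 4 := by
    rw [show (4 : ℝ) = 2 ^ 2 by norm_num]; simp
  rw [cosHalf, h2, ← Real.sqrt_mul (by norm_num), ← Real.sqrt_sq (norm_nonneg ((ω : R3) + σ)), h]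
  congr 1
  ring

theorem cosHalf_pos {x : ℝ} (hx : 0 ≤ x) : 0 < cosHalf x := Real.sqrt_pos.2 (by linarith)

theorem inner_sphere_le_one (ω σ : S2) : inner ℝ (ω : R3) (σ : R3) ≤ 1 := by
  simpa using real_inner_le_norm (ω : R3) σ

theorem cosHalf_le_one {x : ℝ} (hx : x ≤ 1) : cosHalf x ≤ 1 :=
  Real.sqrt_le_one.2 (by linarith)

/-- The total mass, over pairs of directions, of the kernel in Carleman coordinates. -/
noncomputable def carlemanMass (κ : ℝ → ℝ → ENNReal) (u : ℝ) : ENNReal :=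
  ∫⁻ p : S2 × S2, κ (inner ℝ (p.1 : R3) p.2) u *
    ENNReal.ofReal (cosHalf (inner ℝ (p.1 : R3) p.2) ^ 3)⁻¹ ∂(sphereMeasure.prod sphereMeasure)

theorem measurable_carlemanMass {κ : ℝ → ℝ → ENNReal} (hκ : Measurable (Function.uncurry κ)) :
    Measurable (carlemanMass κ) := by
  have := measurable_cosHalf
  unfold carlemanMass
  refine Measurable.lintegral_prod_right' (f := fun q : ℝ × (S2 × S2) =>
    κ (inner ℝ (q.2.1 : R3) q.2.2) q.1 *
      ENNReal.ofReal (cosHalf (inner ℝ (q.2.1 : R3) q.2.2) ^ 3)⁻¹) ?_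
  have h : Measurable fun q : ℝ × (S2 × S2) => κ (inner ℝ (q.2.1 : R3) q.2.2) q.1 :=
    hκ.comp (f := fun q : ℝ × (S2 × S2) => (inner ℝ (q.2.1 : R3) q.2.2, q.1)) (by fun_prop)
  fun_prop

/-- Carleman's change of variables `y = v - v_*'`. -/
theorem lintegral_carleman {κ : ℝ → ℝ → ENNReal} (hκ : Measurable (Function.uncurry κ))
    (hsupp : ∀ x u, x < 0 → κ x u = 0) (hfin : ∀ u, carlemanMass κ u ≠ ⊤)
    {G : R3 → ENNReal} (hG : Measurable G) :
    sphereMeasure univ * ∫⁻ q : (S2 × S2) × Ioi (0 : ℝ),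
        κ (inner ℝ (q.1.1 : R3) q.1.2) (cosHalf (inner ℝ (q.1.1 : R3) q.1.2) * q.2) *
          G (((q.2 : ℝ) / 2) • ((q.1.1 : R3) + q.1.2))
        ∂((sphereMeasure.prod sphereMeasure).prod radialMeasure) =
      ∫⁻ y, carlemanMass κ ‖y‖ * G y := by
  have hc := measurable_cosHalf
  have hκ' : ∀ {α : Type} [MeasurableSpace α] {f g : α → ℝ}, Measurable f → Measurable g →
      Measurable fun a => κ (f a) (g a) := fun hf hg => hκ.comp (hf.prodMk hg)
  set m : R3 × R3 → R3 := fun z => ‖z.1 + z.2‖⁻¹ • (z.1 + z.2) with hm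
  have hmm : Measurable m := by fun_prop
  -- For a fixed pair of directions, substitute `u = t cos(θ/2) = |y|`; the measure `t² dt` yields
  -- the factor `cos(θ/2)^(-3)`. What remains is the bisecting direction `m`, which is
  -- equidistributed by `lintegral_equivariant`.
  have step1 : ∀ p : S2 × S2, ∫⁻ t : Ioi (0 : ℝ),
      κ (inner ℝ (p.1 : R3) p.2) (cosHalf (inner ℝ (p.1 : R3) p.2) * t) *
          G (((t : ℝ) / 2) • ((p.1 : R3) + p.2)) ∂radialMeasure =
      ∫⁻ t : Ioi (0 : ℝ), κ (inner ℝ (p.1 : R3) p.2) t *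
        ENNReal.ofReal (cosHalf (inner ℝ (p.1 : R3) p.2) ^ 3)⁻¹ * G ((t : ℝ) • m (p.1, p.2))
        ∂radialMeasure := by
    intro p
    rcases lt_or_ge (inner ℝ (p.1 : R3) p.2) 0 with hx | hx
    · simp [hsupp _ _ hx]
    · have hcp := cosHalf_pos hx
      have h := lintegral_radialMeasure_comp_mul (c := cosHalf (inner ℝ (p.1 : R3) p.2))
        (g := fun t => κ (inner ℝ (p.1 : R3) p.2) t * G (t • m (p.1, p.2)))
        ((hκ' measurable_const measurable_id).mul (by fun_prop)) hcp
      have hmeas : Measurable fun t : Ioi (0 : ℝ) =>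
          κ (inner ℝ (p.1 : R3) p.2) t * G ((t : ℝ) • m (p.1, p.2)) :=
        (hκ' measurable_const measurable_subtype_coe).mul (by fun_prop)
      rw [← lintegral_const_mul _ hmeas] at h
      refine (Eq.trans (lintegral_congr fun t => ?_) h).trans (lintegral_congr fun t => by ring)
      simp only [hm, norm_add_eq_cosHalf, smul_smul]
      congr 3
      field_simp
  rw [lintegral_prod _ (Measurable.aemeasurable ?_)]
  swap
  · exact (hκ' (by fun_prop) (by fun_prop)).mul (by fun_prop)
  rw [lintegral_congr step1, lintegral_lintegral_swap]
  swap
  · refine Measurable.aemeasurable ?_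
    exact ((hκ' (by fun_prop) (by fun_prop)).mul (by fun_prop)).mul (by fun_prop)
  rw [← lintegral_const_mul]
  swap
  · refine Measurable.lintegral_prod_right' (f := fun q : Ioi (0 : ℝ) × (S2 × S2) =>
      κ (inner ℝ (q.2.1 : R3) q.2.2) q.1 *
      ENNReal.ofReal (cosHalf (inner ℝ (q.2.1 : R3) q.2.2) ^ 3)⁻¹ *
      G ((q.1 : ℝ) • m (q.2.1, q.2.2))) ?_
    exact ((hκ' (by fun_prop) (by fun_prop)).mul (by fun_prop)).mul (by fun_prop)
  rw [lintegral_polar (G := fun y => carlemanMass κ ‖y‖ * G y)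
    (((measurable_carlemanMass hκ).comp measurable_norm).mul hG)]
  refine lintegral_congr fun t => ?_
  have h := lintegral_equivariant
    (k := fun x => κ x t * ENNReal.ofReal (cosHalf x ^ 3)⁻¹)
    ((hκ' measurable_id measurable_const).mul (by fun_prop)) (hfin t) hmm
    (fun L x y => by simp only [hm, ← map_add, L.norm_map, map_smul]) ?_
    (G := fun y => G ((t : ℝ) • y)) (by fun_prop)
  · rw [h, ← carlemanMass, ← lintegral_const_mul _ (by fun_prop)]
    refine lintegral_congr fun ω => ?_
    simp [norm_smul, abs_of_pos (show (0 : ℝ) < t from t.2)]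
  · intro ω σ hne
    have hx : 0 ≤ inner ℝ (ω : R3) (σ : R3) := by
      by_contra hx
      simp [hsupp _ _ (not_le.1 hx)] at hne
    have := cosHalf_pos hx
    simp only [hm, norm_smul, norm_inv, norm_add_eq_cosHalf]
    rw [Real.norm_of_nonneg (by positivity)]
    field_simp

/-- Polar coordinates for the variable `v - v_*`. -/
theorem lintegral_weight_polar {k : ℝ → ENNReal} (hk : Measurable k)
    (hfin : ∫⁻ p : S2 × S2, k (inner ℝ (p.1 : R3) p.2) ∂(sphereMeasure.prod sphereMeasure) ≠ ⊤)
    {G : R3 → ENNReal} (hG : Measurable G) :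
    sphereMeasure univ * ∫⁻ q : (S2 × S2) × Ioi (0 : ℝ),
        k (inner ℝ (q.1.1 : R3) q.1.2) * G ((q.2 : ℝ) • (q.1.1 : R3))
        ∂((sphereMeasure.prod sphereMeasure).prod radialMeasure) =
      (∫⁻ p : S2 × S2, k (inner ℝ (p.1 : R3) p.2) ∂(sphereMeasure.prod sphereMeasure)) *
        ∫⁻ y, G y := by
  rw [lintegral_prod_symm' _ (by fun_prop), lintegral_polar hG,
    ← lintegral_const_mul _ (by fun_prop), ← lintegral_const_mul _ (by fun_prop)]
  refine lintegral_congr fun t => ?_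
  exact lintegral_equivariant hk hfin (m := Prod.fst) measurable_fst (fun _ _ _ => rfl)
    (fun ω _ _ => by simp) (G := fun y => G ((t : ℝ) • y)) (by fun_prop)

/-! ### The singular angular integral. -/

-- After a rotation to the first basis vector, the cone over the cap lies in the box `[-1, 1] × [-a,
-- a]²` of volume `8 a²`; the factor `3` of the cone formula gives `24`.
open scoped Pointwise in
theorem sphereMeasure_cap_le (ω : S2) {a : ℝ} (ha : 0 < a) :
    sphereMeasure {σ : S2 | ‖(σ : R3) - ω‖ < a} ≤ ENNReal.ofReal (24 * a ^ 2) := by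
  set e : R3 := EuclideanSpace.single 0 1 with he
  obtain ⟨L, hL⟩ := exists_linearIsometryEquiv_eq (x := (ω : R3)) (y := e) (by simp [he])
  have hmeas : MeasurableSet {σ : S2 | ‖(σ : R3) - e‖ < a} :=
    measurableSet_lt (by fun_prop) measurable_const
  have h1 : {σ : S2 | ‖(σ : R3) - ω‖ < a} = sphereMap L ⁻¹' {σ : S2 | ‖(σ : R3) - e‖ < a} := by
    ext σ
    simp only [mem_preimage, mem_ofPred_eq, sphereMap, ← hL, ← map_sub, L.norm_map]
  rw [h1, (measurePreserving_sphereMap L).measure_preimage hmeas.nullMeasurableSet,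
    Measure.toSphere_apply' _ hmeas]
  set w : Fin 3 → ℝ := ![1, a, a] with hw
  have hsub : (Ioo (0 : ℝ) 1 • ((↑) '' {σ : S2 | ‖(σ : R3) - e‖ < a}) : Set R3) ⊆
      (WithLp.ofLp : R3 → Fin 3 → ℝ) ⁻¹' (Set.Icc (-w) w) := by
    rintro x ⟨t, ht, y, ⟨σ, hσ, rfl⟩, rfl⟩
    have hc : ∀ i, |(σ : R3) i - e i| < a := fun i =>
      lt_of_le_of_lt (by simpa using PiLp.norm_apply_le ((σ : R3) - e) i) hσ
    have h0 : |(σ : R3) 0| ≤ 1 := by simpa using PiLp.norm_apply_le (σ : R3) 0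
    have hi : ∀ i, |t * (σ : R3) i| ≤ w i := by
      intro i
      rw [abs_mul, abs_of_pos ht.1]
      have e1 := hc 1
      have e2 := hc 2
      simp [he] at e1 e2
      fin_cases i <;> simp [hw]
      · nlinarith [ht.1, ht.2, abs_nonneg ((σ : R3) 0)]
      · nlinarith [ht.1, ht.2, abs_nonneg ((σ : R3) 1)]
      · nlinarith [ht.1, ht.2, abs_nonneg ((σ : R3) 2)]
    exact ⟨fun i => (abs_le.1 (hi i)).1, fun i => (abs_le.1 (hi i)).2⟩
  have hvol : volume ((WithLp.ofLp : R3 → Fin 3 → ℝ) ⁻¹' (Set.Icc (-w) w)) =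
      ENNReal.ofReal (8 * a ^ 2) := by
    rw [(PiLp.volume_preserving_ofLp (Fin 3)).measure_preimage
      measurableSet_Icc.nullMeasurableSet, Real.volume_Icc_pi,
      ← ENNReal.ofReal_prod_of_nonneg]
    · congr 1
      simp [Fin.prod_univ_three, hw]
      ring
    · intro i _
      fin_cases i <;> simp [hw] <;> linarith
  calc _ ≤ ((Module.finrank ℝ R3 : ℕ) : ENNReal) * ENNReal.ofReal (8 * a ^ 2) := by
        gcongr
        rw [← hvol]
        exact measure_mono hsub
    _ = _ := by
        rw [← ENNReal.ofReal_natCast, ← ENNReal.ofReal_mul (by positivity)]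
        congr 1
        simp
        ring

theorem setLIntegral_rpow_mul_min_le {s : ℝ} (hs₀ : 0 < s) (hs₁ : s < 1) {A : ℝ} (hA : 0 < A) :
    ∫⁻ a in Ioi (0 : ℝ), ENNReal.ofReal (a ^ (-1 - 2 * s) * min (A * a ^ 2) 1) ≤
      ENNReal.ofReal ((1 / (2 - 2 * s) + 1 / (2 * s)) * A ^ s) := by
  -- `A R² = 1`: the minimum changes branch at `R`.
  set R : ℝ := A ^ (-(1 / 2) : ℝ) with hR
  have hRpos : 0 < R := Real.rpow_pos_of_pos hA _
  rw [← Ioc_union_Ioi_eq_Ioi hRpos.le]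
  refine (lintegral_union_le _ _ _).trans ?_
  have i1 : IntegrableOn (fun a : ℝ => A * a ^ (1 - 2 * s)) (Ioc 0 R) := by
    have := (intervalIntegral.intervalIntegrable_rpow' (a := 0) (b := R)
      (r := 1 - 2 * s) (by linarith)).const_mul A
    rwa [intervalIntegrable_iff_integrableOn_Ioc_of_le hRpos.le] at this
  have b1 : ∫⁻ a in Ioc (0 : ℝ) R, ENNReal.ofReal (a ^ (-1 - 2 * s) * min (A * a ^ 2) 1) ≤
      ENNReal.ofReal (1 / (2 - 2 * s) * A ^ s) := by
    calc _ ≤ ∫⁻ a in Ioc (0 : ℝ) R, ENNReal.ofReal (A * a ^ (1 - 2 * s)) := by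
          refine setLIntegral_mono' measurableSet_Ioc fun a ha => ENNReal.ofReal_le_ofReal ?_
          calc a ^ (-1 - 2 * s) * min (A * a ^ 2) 1 ≤ a ^ (-1 - 2 * s) * (A * a ^ 2) := by
                gcongr
                · exact Real.rpow_nonneg ha.1.le _
                · exact min_le_left _ _
            _ = A * a ^ (1 - 2 * s) := by
                rw [← Real.rpow_natCast, mul_left_comm, ← Real.rpow_add ha.1]
                congr 2
                push_cast
                ring
      _ = ENNReal.ofReal (∫ a in Ioc (0 : ℝ) R, A * a ^ (1 - 2 * s)) := by
          rw [ofReal_integral_eq_lintegral_ofReal i1]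
          filter_upwards [ae_restrict_mem measurableSet_Ioc] with a ha
          have := Real.rpow_nonneg ha.1.le (1 - 2 * s)
          positivity
      _ = _ := by
          congr 1
          rw [← intervalIntegral.integral_of_le hRpos.le, intervalIntegral.integral_const_mul,
            integral_rpow (Or.inl (by linarith)), Real.zero_rpow (by linarith), hR,
            ← Real.rpow_mul hA.le, sub_zero, mul_div_assoc', ← Real.rpow_one_add' hA.le]
          · rw [show 1 + -(1 / 2) * (1 - 2 * s + 1) = s by ring,
              show 1 - 2 * s + 1 = 2 - 2 * s by ring]
            ring
          · intro h
            linarith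
  have b2 : ∫⁻ a in Ioi R, ENNReal.ofReal (a ^ (-1 - 2 * s) * min (A * a ^ 2) 1) ≤
      ENNReal.ofReal (1 / (2 * s) * A ^ s) := by
    calc _ ≤ ∫⁻ a in Ioi R, ENNReal.ofReal (a ^ (-1 - 2 * s)) := by
          refine setLIntegral_mono' measurableSet_Ioi fun a ha => ENNReal.ofReal_le_ofReal ?_
          have := Real.rpow_nonneg (hRpos.trans ha).le (-1 - 2 * s)
          exact mul_le_of_le_one_right this (min_le_right _ _)
      _ = ENNReal.ofReal (∫ a in Ioi R, a ^ (-1 - 2 * s)) := by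
          rw [ofReal_integral_eq_lintegral_ofReal
            (integrableOn_Ioi_rpow_of_lt (by linarith) hRpos)]
          filter_upwards [ae_restrict_mem measurableSet_Ioi] with a ha
          exact Real.rpow_nonneg (hRpos.trans ha).le _
      _ = _ := by
          congr 1
          rw [integral_Ioi_rpow_of_lt (by linarith) hRpos, hR, ← Real.rpow_mul hA.le,
            show -(1 / 2) * (-1 - 2 * s + 1) = s by ring,
            show -1 - 2 * s + 1 = -(2 * s) by ring]
          rw [neg_div_neg_eq]
          ring
  refine (add_le_add b1 b2).trans ?_
  have h1 : 0 < 2 - 2 * s := by linarith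
  rw [← ENNReal.ofReal_add (by positivity) (by positivity), add_mul]

/-- Layer cake: `d^(-2-2s) = (2 + 2s) ∫_d^∞ a^(-3-2s) da`, and the minimum can be moved inside with
`d` replaced by the larger `a`. Exchanging the integrals leaves the measure of a cap of radius `a`,
hence a one-dimensional integral. -/
theorem lintegral_sphere_singular_le {s : ℝ} (hs₀ : 0 < s) (hs₁ : s < 1) {A : ℝ} (hA : 0 < A)
    (ω : S2) :
    ∫⁻ σ : S2, ENNReal.ofReal
        (‖(σ : R3) - ω‖ ^ (-2 - 2 * s) * min (A * ‖(σ : R3) - ω‖ ^ 2) 1) ∂sphereMeasure ≤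
      ENNReal.ofReal (24 * (2 + 2 * s) * (1 / (2 - 2 * s) + 1 / (2 * s)) * A ^ s) := by
  set φ : ℝ → ENNReal := fun a =>
    ENNReal.ofReal ((2 + 2 * s) * (a ^ (-3 - 2 * s) * min (A * a ^ 2) 1)) with hφ
  have hφm : Measurable φ := by fun_prop
  have key : ∀ d : ℝ, 0 ≤ d → ENNReal.ofReal (d ^ (-2 - 2 * s) * min (A * d ^ 2) 1) ≤
      ∫⁻ a in Ioi (0 : ℝ), (Ioi d).indicator φ a := by
    intro d hd
    rcases hd.eq_or_lt with rfl | hd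
    · simp
    rw [setLIntegral_indicator measurableSet_Ioi, Ioi_inter_Ioi, sup_eq_left.2 hd.le]
    have hneg : -3 - 2 * s < -1 := by linarith
    have hint := integrableOn_Ioi_rpow_of_lt hneg hd
    calc _ = ENNReal.ofReal (∫ a in Ioi d, (2 + 2 * s) * min (A * d ^ 2) 1 *
            a ^ (-3 - 2 * s)) := by
          congr 1
          rw [integral_const_mul, integral_Ioi_rpow_of_lt hneg hd,
            show -3 - 2 * s + 1 = -(2 + 2 * s) by ring, neg_div_neg_eq,
            show -2 - 2 * s = -(2 + 2 * s) by ring]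
          have : 2 + 2 * s ≠ 0 := by linarith
          field_simp
      _ = ∫⁻ a in Ioi d, ENNReal.ofReal ((2 + 2 * s) * min (A * d ^ 2) 1 *
            a ^ (-3 - 2 * s)) := by
          rw [ofReal_integral_eq_lintegral_ofReal (hint.const_mul _)]
          filter_upwards [ae_restrict_mem measurableSet_Ioi] with a ha
          have := Real.rpow_nonneg (hd.trans ha).le (-3 - 2 * s)
          have : 0 ≤ min (A * d ^ 2) 1 := by positivity
          positivity
      _ ≤ _ := by
          refine setLIntegral_mono' measurableSet_Ioi fun a ha => ENNReal.ofReal_le_ofReal ?_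
          have h0 := Real.rpow_nonneg (hd.trans ha).le (-3 - 2 * s)
          have h1 : min (A * d ^ 2) 1 ≤ min (A * a ^ 2) 1 := by
            have : d < a := ha
            gcongr
          calc _ = (2 + 2 * s) * (a ^ (-3 - 2 * s) * min (A * d ^ 2) 1) := by ring
            _ ≤ _ := by gcongr
  calc _ ≤ ∫⁻ σ : S2, (∫⁻ a in Ioi (0 : ℝ), (Ioi ‖(σ : R3) - ω‖).indicator φ a) ∂sphereMeasure :=
        lintegral_mono fun σ => key _ (norm_nonneg _)
    _ = ∫⁻ a in Ioi (0 : ℝ), ∫⁻ σ : S2, (Ioi ‖(σ : R3) - ω‖).indicator φ a ∂sphereMeasure := by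
        refine lintegral_lintegral_swap (Measurable.aemeasurable ?_)
        have : MeasurableSet {q : S2 × ℝ | ‖(q.1 : R3) - ω‖ < q.2} :=
          measurableSet_lt (by fun_prop) (by fun_prop)
        exact (hφm.comp measurable_snd).indicator this
    _ ≤ ∫⁻ a in Ioi (0 : ℝ), ENNReal.ofReal (24 * (2 + 2 * s)) *
          ENNReal.ofReal (a ^ (-1 - 2 * s) * min (A * a ^ 2) 1) := by
        refine setLIntegral_mono' measurableSet_Ioi fun a ha => ?_
        have ha : 0 < a := ha
        have hm : MeasurableSet {σ : S2 | ‖(σ : R3) - ω‖ < a} :=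
          measurableSet_lt (by fun_prop) measurable_const
        have e1 : ∀ σ : S2, (Ioi ‖(σ : R3) - ω‖).indicator φ a =
            {σ : S2 | ‖(σ : R3) - ω‖ < a}.indicator (fun _ => φ a) σ := fun σ => rfl
        rw [lintegral_congr e1, lintegral_indicator_const hm]
        have hmin : 0 ≤ min (A * a ^ 2) 1 := by positivity
        calc _ ≤ φ a * ENNReal.ofReal (24 * a ^ 2) := by
              gcongr
              exact sphereMeasure_cap_le ω ha
          _ = _ := by
              rw [hφ, ← ENNReal.ofReal_mul (by positivity), ← ENNReal.ofReal_mul (by positivity)]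
              congr 1
              rw [show (-1 - 2 * s : ℝ) = (-3 - 2 * s) + (2 : ℕ) by push_cast; ring,
                Real.rpow_add ha, Real.rpow_natCast]
              ring
    _ = ENNReal.ofReal (24 * (2 + 2 * s)) *
          ∫⁻ a in Ioi (0 : ℝ), ENNReal.ofReal (a ^ (-1 - 2 * s) * min (A * a ^ 2) 1) :=
        lintegral_const_mul _ (by fun_prop)
    _ ≤ ENNReal.ofReal (24 * (2 + 2 * s)) *
          ENNReal.ofReal ((1 / (2 - 2 * s) + 1 / (2 * s)) * A ^ s) := by
        gcongr
        exact setLIntegral_rpow_mul_min_le hs₀ hs₁ hA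
    _ = _ := by
        rw [← ENNReal.ofReal_mul (by positivity)]
        congr 1
        ring

/-! ### Collision coordinates and folding of the angle. -/

theorem integral_comp_measurePreserving {α β : Type*} [MeasurableSpace α] [MeasurableSpace β]
    {μ : Measure α} {ν : Measure β} {φ : α → β} (h : MeasurePreserving φ μ ν) {F : β → ℝ}
    (hF : AEStronglyMeasurable F ν) : ∫ a, F (φ a) ∂μ = ∫ b, F b ∂ν := by
  rw [← h.map_eq] at hF ⊢
  exact (integral_map h.measurable.aemeasurable hF).symm

/-- Collisions `((ω, σ), t)` with `v - v_* = t ω`. -/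
abbrev CollisionSpace : Type := (S2 × S2) × Ioi (0 : ℝ)

noncomputable abbrev collisionMeasure : Measure CollisionSpace :=
  (sphereMeasure.prod sphereMeasure).prod radialMeasure

/-- The cosine of the deviation angle. -/
noncomputable def cosDev (q : CollisionSpace) : ℝ := inner ℝ (q.1.1 : R3) (q.1.2 : R3)

noncomputable def preStar (v : R3) (q : CollisionSpace) : R3 := v - (q.2 : ℝ) • (q.1.1 : R3)

noncomputable def postStar (v : R3) (q : CollisionSpace) : R3 :=
  v - ((q.2 : ℝ) / 2) • ((q.1.1 : R3) + q.1.2)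

/-- The displacement `v' - v`. -/
noncomputable def jump (q : CollisionSpace) : R3 := ((q.2 : ℝ) / 2) • ((q.1.2 : R3) - q.1.1)

@[fun_prop]
theorem measurable_cosDev : Measurable cosDev := by unfold cosDev; fun_prop

@[fun_prop]
theorem measurable_preStar (v : R3) : Measurable (preStar v) := by unfold preStar; fun_prop

@[fun_prop]
theorem measurable_postStar (v : R3) : Measurable (postStar v) := by unfold postStar; fun_prop

@[fun_prop]
theorem measurable_jump : Measurable jump := by unfold jump; fun_prop

attribute [fun_prop] measurable_cosHalf

theorem cosDev_le_one (q : CollisionSpace) : cosDev q ≤ 1 := inner_sphere_le_one _ _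

theorem norm_jump_sq (q : CollisionSpace) :
    ‖jump q‖ ^ 2 = (q.2 : ℝ) ^ 2 * (1 - cosDev q) / 2 := by
  have : ‖(q.1.2 : R3) - q.1.1‖ ^ 2 = 2 - 2 * cosDev q := by
    rw [norm_sub_sq_real, real_inner_comm, cosDev]; simp; ring
  rw [jump, norm_smul, mul_pow, this, Real.norm_eq_abs, sq_abs]
  ring

/-- Folding of an angular kernel to deviation angles at most `π / 2`. -/
noncomputable def foldKernel (k : ℝ → ℝ) (x : ℝ) : ℝ :=
  (if 0 ≤ x then k x else 0) + (if 0 < x then k (-x) else 0)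

theorem measurable_foldKernel {k : ℝ → ℝ} (hk : Measurable k) : Measurable (foldKernel k) :=
  (hk.ite measurableSet_Ici measurable_const).add
    ((hk.comp measurable_neg).ite measurableSet_Ioi measurable_const)

theorem foldKernel_nonneg {k : ℝ → ℝ} (hk : ∀ x, 0 ≤ k x) (x : ℝ) : 0 ≤ foldKernel k x := by
  unfold foldKernel
  split_ifs <;> simp [hk, add_nonneg]

theorem foldKernel_of_neg (k : ℝ → ℝ) {x : ℝ} (hx : x < 0) : foldKernel k x = 0 := by
  simp [foldKernel, hx.not_ge, hx.not_gt]

theorem foldKernel_le {k : ℝ → ℝ} {M : ℝ} (hk : ∀ x, 0 ≤ k x) (hM : ∀ x, k x ≤ M) (x : ℝ) :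
    foldKernel k x ≤ 2 * M := by
  have h0 := (hk 0).trans (hM 0)
  have h1 := hM x
  have h2 := hM (-x)
  unfold foldKernel
  split_ifs <;> linarith

/-- Exchanging the two outgoing particles folds the angular kernel. -/
theorem integral_fold {γ : ℝ} {k : ℝ → ℝ} {g : R3 → ℝ} {v : R3}
    (hint : Integrable (fun q : CollisionSpace => (q.2 : ℝ) ^ γ * k (cosDev q) *
      (g (postStar v q) * g (v + jump q) - g (preStar v q) * g v)) collisionMeasure) :
    Integrable (fun q : CollisionSpace => (q.2 : ℝ) ^ γ * foldKernel k (cosDev q) *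
      (g (postStar v q) * g (v + jump q) - g (preStar v q) * g v)) collisionMeasure ∧
    ∫ q : CollisionSpace, (q.2 : ℝ) ^ γ * foldKernel k (cosDev q) *
      (g (postStar v q) * g (v + jump q) - g (preStar v q) * g v) ∂collisionMeasure =
    ∫ q : CollisionSpace, (q.2 : ℝ) ^ γ * k (cosDev q) *
      (g (postStar v q) * g (v + jump q) - g (preStar v q) * g v) ∂collisionMeasure := by
  set F : CollisionSpace → ℝ := fun q => (q.2 : ℝ) ^ γ * k (cosDev q) *
      (g (postStar v q) * g (v + jump q) - g (preStar v q) * g v) with hF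
  set S : Set CollisionSpace := {q | 0 ≤ cosDev q} with hS
  have hSm : MeasurableSet S := measurableSet_le measurable_const measurable_cosDev
  have i1 := hint.indicator hSm
  have i2 := hint.indicator hSm.compl
  have i3 : Integrable (fun q : CollisionSpace => Sᶜ.indicator F ((q.1.1, -q.1.2), q.2))
      collisionMeasure := measurePreserving_flip.integrable_comp_of_integrable i2
  have e3 := integral_comp_measurePreserving measurePreserving_flip i2.aestronglyMeasurable
  have hsum : (fun q : CollisionSpace => (q.2 : ℝ) ^ γ * foldKernel k (cosDev q) *
      (g (postStar v q) * g (v + jump q) - g (preStar v q) * g v)) =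
      fun q => S.indicator F q + Sᶜ.indicator F ((q.1.1, -q.1.2), q.2) := by
    funext q
    have hcos : cosDev ((q.1.1, -q.1.2), q.2) = - cosDev q := by simp [cosDev]
    have hpost : postStar v ((q.1.1, -q.1.2), q.2) = v + jump q := by
      simp only [postStar, jump, coe_neg_sphere]
      module
    have hjump : v + jump ((q.1.1, -q.1.2), q.2) = postStar v q := by
      simp only [postStar, jump, coe_neg_sphere]
      module
    have hpre : preStar v ((q.1.1, -q.1.2), q.2) = preStar v q := rfl
    have m1 : q ∈ S ↔ 0 ≤ cosDev q := Iff.rfl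
    -- The inequality is strict here, so collisions with `θ = π/2` are counted only once.
    have m2 : (((q.1.1, -q.1.2), q.2) : CollisionSpace) ∈ Sᶜ ↔ 0 < cosDev q := by
      rw [mem_compl_iff, hS, mem_ofPred_eq, hcos]
      simp
    by_cases h1 : 0 ≤ cosDev q <;> by_cases h2 : 0 < cosDev q
    · rw [indicator_of_mem (m1.2 h1), indicator_of_mem (m2.2 h2), hF]
      simp only [foldKernel, h1, h2, if_true, hcos, hpost, hjump, hpre]
      ring
    · rw [indicator_of_mem (m1.2 h1), indicator_of_notMem (mt m2.1 h2), hF]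
      simp only [foldKernel, h1, h2, if_true, if_false]
      ring
    · exact absurd h2.le h1
    · rw [indicator_of_notMem (mt m1.1 h1), indicator_of_notMem (mt m2.1 h2)]
      simp [foldKernel, h1, h2]
  rw [hsum]
  refine ⟨i1.add i3, ?_⟩
  rw [integral_add i1 i3, e3, ← integral_add i1 i2]
  exact integral_congr_ae (Eventually.of_forall fun q => indicator_self_add_compl_apply S F q)

/-! ### Lower bound for the collision integral with a bounded folded kernel. -/

/-- The weight `cos(θ / 2) ^ (-3 - γ)` at `θ = π / 2`. -/
noncomputable def maxJacobian (γ : ℝ) : ℝ := cosHalf 0 ^ (-(γ + 3))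

theorem maxJacobian_pos (γ : ℝ) : 0 < maxJacobian γ :=
  Real.rpow_pos_of_pos (cosHalf_pos le_rfl) _

theorem cosHalf_rpow_mul {γ x : ℝ} (hx : 0 ≤ x) :
    cosHalf x ^ (-γ) * (cosHalf x ^ 3)⁻¹ = cosHalf x ^ (-(γ + 3)) := by
  have h := cosHalf_pos hx
  rw [← Real.rpow_natCast, ← Real.rpow_neg h.le, ← Real.rpow_add h]
  congr 1
  push_cast
  ring

theorem one_le_cosHalf_rpow {γ x : ℝ} (hγ : -3 < γ) (hx : 0 ≤ x) (hx1 : x ≤ 1) :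
    1 ≤ cosHalf x ^ (-(γ + 3)) :=
  Real.one_le_rpow_of_pos_of_le_one_of_nonpos (cosHalf_pos hx) (cosHalf_le_one hx1) (by linarith)

theorem cosHalf_rpow_le {γ x : ℝ} (hγ : -3 < γ) (hx : 0 ≤ x) :
    cosHalf x ^ (-(γ + 3)) ≤ maxJacobian γ :=
  Real.rpow_le_rpow_of_nonpos (cosHalf_pos le_rfl) (Real.sqrt_le_sqrt (by linarith)) (by linarith)

theorem norm_half_smul_add (q : CollisionSpace) :
    ‖((q.2 : ℝ) / 2) • ((q.1.1 : R3) + q.1.2)‖ = cosHalf (cosDev q) * q.2 := by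
  have ht : (0 : ℝ) < q.2 := q.2.2
  rw [norm_smul, norm_add_eq_cosHalf, Real.norm_of_nonneg (by positivity), cosDev]
  ring

/-- The gain weight in Carleman coordinates. -/
theorem weight_eq_carleman {γ : ℝ} {K : ℝ → ℝ} (hK : ∀ x < 0, K x = 0)
    (g : R3 → ℝ) (v : R3) (q : CollisionSpace) :
    (q.2 : ℝ) ^ γ * K (cosDev q) * g (postStar v q) =
      K (cosDev q) * cosHalf (cosDev q) ^ (-γ) *
        (‖((q.2 : ℝ) / 2) • ((q.1.1 : R3) + q.1.2)‖ ^ γ *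
          g (v - ((q.2 : ℝ) / 2) • ((q.1.1 : R3) + q.1.2))) := by
  have ht : (0 : ℝ) < q.2 := q.2.2
  rcases lt_or_ge (cosDev q) 0 with hx | hx
  · simp [hK _ hx]
  · have hc := cosHalf_pos hx
    rw [norm_half_smul_add, Real.mul_rpow hc.le ht.le, Real.rpow_neg hc.le, postStar]
    have := (Real.rpow_pos_of_pos hc γ).ne'
    field_simp

/-- Carleman's formula for the gain weight. The extra factor `m` is `1` for the total gain and the
truncated square of the jump for the singular part. Since `K` lives on `θ ≤ π/2`, the Jacobian is at
most its value at `π/2`. -/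
theorem lintegral_gain {γ : ℝ} (hγ : -3 < γ) {K : ℝ → ℝ} (hKm : Measurable K)
    (hK0 : ∀ x, 0 ≤ K x) {M : ℝ} (hKM : ∀ x, K x ≤ M) (hKneg : ∀ x < 0, K x = 0)
    {m : ℝ → ℝ → ℝ} (hm : Measurable (Function.uncurry m)) (hm0 : ∀ x u, 0 ≤ m x u)
    (hm1 : ∀ x u, m x u ≤ 1) {g : R3 → ℝ} (hg : Measurable g) (v : R3) :
    (∀ u, carlemanMass (fun x u => ENNReal.ofReal (K x * cosHalf x ^ (-γ) * m x u)) u ≤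
      ∫⁻ p : S2 × S2, ENNReal.ofReal (maxJacobian γ * (K (inner ℝ (p.1 : R3) p.2) *
        m (inner ℝ (p.1 : R3) p.2) u)) ∂(sphereMeasure.prod sphereMeasure)) ∧
    sphereMeasure univ * ∫⁻ q : CollisionSpace, ENNReal.ofReal ((q.2 : ℝ) ^ γ *
        K (cosDev q) * g (postStar v q) * m (cosDev q) (cosHalf (cosDev q) * q.2))
        ∂collisionMeasure =
      ∫⁻ y, carlemanMass (fun x u => ENNReal.ofReal (K x * cosHalf x ^ (-γ) * m x u)) ‖y‖ *
        ENNReal.ofReal (‖y‖ ^ γ * g (v - y)) := by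
  have hcm := measurable_cosHalf
  have hb : ∀ u, carlemanMass (fun x u => ENNReal.ofReal (K x * cosHalf x ^ (-γ) * m x u)) u ≤
      ∫⁻ p : S2 × S2, ENNReal.ofReal (maxJacobian γ * (K (inner ℝ (p.1 : R3) p.2) *
        m (inner ℝ (p.1 : R3) p.2) u)) ∂(sphereMeasure.prod sphereMeasure) := by
    intro u
    refine lintegral_mono fun p => ?_
    set x : ℝ := inner ℝ (p.1 : R3) (p.2 : R3) with hx
    have hc0 : 0 ≤ cosHalf x := Real.sqrt_nonneg _
    rw [← ENNReal.ofReal_mul' (by positivity)]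
    refine ENNReal.ofReal_le_ofReal ?_
    rcases lt_or_ge x 0 with hx0 | hx0
    · simp [hKneg _ hx0]
    · calc _ = cosHalf x ^ (-γ) * (cosHalf x ^ 3)⁻¹ * (K x * m x u) := by ring
        _ ≤ _ := by
          rw [cosHalf_rpow_mul hx0]
          exact mul_le_mul_of_nonneg_right (cosHalf_rpow_le hγ hx0)
            (mul_nonneg (hK0 _) (hm0 _ _))
  refine ⟨hb, ?_⟩
  rw [← lintegral_carleman]
  · congr 1
    refine lintegral_congr fun q => ?_
    have h0 : 0 ≤ K (cosDev q) * cosHalf (cosDev q) ^ (-γ) *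
        m (cosDev q) (cosHalf (cosDev q) * q.2) :=
      mul_nonneg (mul_nonneg (hK0 _) (Real.rpow_nonneg (Real.sqrt_nonneg _) _)) (hm0 _ _)
    rw [weight_eq_carleman hKneg]
    refine Eq.trans ?_ (ENNReal.ofReal_mul h0)
    exact congrArg ENNReal.ofReal (mul_right_comm _ _ _)
  · refine ENNReal.measurable_ofReal.comp ?_
    exact ((hKm.comp measurable_fst).mul ((hcm.comp measurable_fst).pow_const _)).mul hm
  · intro x u hx
    simp [hKneg x hx]
  · intro u
    refine ((hb u).trans (lintegral_mono fun p => ENNReal.ofReal_le_ofReal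
      (?_ : _ ≤ maxJacobian γ * M))).trans_lt ?_ |>.ne
    · have := maxJacobian_pos γ
      have := hm1 (inner ℝ (p.1 : R3) p.2) u
      have h1 := hKM (inner ℝ (p.1 : R3) p.2)
      have h2 := hK0 (inner ℝ (p.1 : R3) p.2)
      gcongr
      nlinarith [hm0 (inner ℝ (p.1 : R3) p.2) u]
    · rw [lintegral_const]
      exact ENNReal.mul_lt_top ENNReal.ofReal_lt_top (measure_lt_top _ _)
  · fun_prop

theorem sphereMeasure_univ_ne_zero : sphereMeasure univ ≠ 0 := by
  rw [Measure.measure_univ_ne_zero]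
  exact Measure.toSphere_ne_zero _

/-- The loss and gain masses are finite, and the loss does not exceed the gain. -/
theorem integrable_loss_gain {γ : ℝ} (hγ : -3 < γ) {K : ℝ → ℝ} (hKm : Measurable K)
    (hK0 : ∀ x, 0 ≤ K x) {M : ℝ} (hKM : ∀ x, K x ≤ M) (hKneg : ∀ x < 0, K x = 0)
    {g : R3 → ℝ} (hg : Measurable g) (hg0 : ∀ w, 0 ≤ g w) {v : R3}
    (hL : ∫⁻ y, ENNReal.ofReal (‖y‖ ^ γ * g (v - y)) ≠ ⊤) :
    Integrable (fun q : CollisionSpace => (q.2 : ℝ) ^ γ * K (cosDev q) * g (preStar v q))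
      collisionMeasure ∧
    Integrable (fun q : CollisionSpace => (q.2 : ℝ) ^ γ * K (cosDev q) * g (postStar v q))
      collisionMeasure ∧
    ∫ q : CollisionSpace, (q.2 : ℝ) ^ γ * K (cosDev q) * g (preStar v q) ∂collisionMeasure ≤
      ∫ q : CollisionSpace, (q.2 : ℝ) ^ γ * K (cosDev q) * g (postStar v q) ∂collisionMeasure := by
  have hμ0 := sphereMeasure_univ_ne_zero
  have hμt : sphereMeasure univ ≠ ⊤ := measure_ne_top _ _
  have hcm := measurable_cosHalf
  set G : R3 → ENNReal := fun y => ENNReal.ofReal (‖y‖ ^ γ * g (v - y)) with hG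
  have hGm : Measurable G := by fun_prop
  set mass := ∫⁻ p : S2 × S2, ENNReal.ofReal (K (inner ℝ (p.1 : R3) p.2))
    ∂(sphereMeasure.prod sphereMeasure) with hmass
  have hmass_fin : mass ≠ ⊤ := by
    refine ((lintegral_mono fun p => ENNReal.ofReal_le_ofReal (hKM _)).trans_lt ?_).ne
    rw [lintegral_const]
    exact ENNReal.mul_lt_top ENNReal.ofReal_lt_top (measure_lt_top _ _)
  have nn : ∀ (h : CollisionSpace → R3) (q : CollisionSpace),
      0 ≤ (q.2 : ℝ) ^ γ * K (cosDev q) * g (h q) := fun h q =>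
    mul_nonneg (mul_nonneg (Real.rpow_nonneg (le_of_lt q.2.2) _) (hK0 _)) (hg0 _)
  -- the loss term
  have hloss : sphereMeasure univ * ∫⁻ q : CollisionSpace, ENNReal.ofReal
      ((q.2 : ℝ) ^ γ * K (cosDev q) * g (preStar v q)) ∂collisionMeasure =
      mass * ∫⁻ y, G y := by
    rw [← lintegral_weight_polar (k := fun x => ENNReal.ofReal (K x)) (by fun_prop) hmass_fin hGm]
    congr 1
    refine lintegral_congr fun q => ?_
    have ht : (0 : ℝ) < q.2 := q.2.2
    rw [← ENNReal.ofReal_mul (hK0 _), norm_smul, Real.norm_of_nonneg ht.le]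
    simp only [norm_eq_of_mem_sphere, mul_one]
    exact congrArg ENNReal.ofReal (by rw [mul_comm (_ ^ γ), mul_assoc]; rfl)
  -- the gain term
  obtain ⟨hb, hgain⟩ := lintegral_gain hγ hKm hK0 hKM hKneg (m := fun _ _ => 1)
    measurable_const (fun _ _ => zero_le_one) (fun _ _ => le_rfl) hg v
  simp only [mul_one] at hb hgain
  -- The cancellation lemma as an inequality: the Jacobian `cos(θ/2)^(-(γ+3))` is at least `1`
  -- because `γ > -3`.
  have hlow : mass * ∫⁻ y, G y ≤ sphereMeasure univ * ∫⁻ q : CollisionSpace, ENNReal.ofReal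
      ((q.2 : ℝ) ^ γ * K (cosDev q) * g (postStar v q)) ∂collisionMeasure := by
    rw [hgain, ← lintegral_const_mul _ hGm]
    refine lintegral_mono fun y => mul_le_mul_left ?_ _
    refine lintegral_mono fun p => ?_
    set x : ℝ := inner ℝ (p.1 : R3) (p.2 : R3) with hx
    have hc0 : 0 ≤ cosHalf x := Real.sqrt_nonneg _
    rw [← ENNReal.ofReal_mul' (by positivity)]
    refine ENNReal.ofReal_le_ofReal ?_
    rcases lt_or_ge x 0 with hx0 | hx0
    · simp [hKneg _ hx0]
    · rw [mul_assoc, cosHalf_rpow_mul hx0]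
      exact le_mul_of_one_le_right (hK0 _) (one_le_cosHalf_rpow hγ hx0 (inner_sphere_le_one _ _))
  have hup : sphereMeasure univ * ∫⁻ q : CollisionSpace, ENNReal.ofReal
      ((q.2 : ℝ) ^ γ * K (cosDev q) * g (postStar v q)) ∂collisionMeasure ≤
      ENNReal.ofReal (maxJacobian γ) * mass * ∫⁻ y, G y := by
    rw [hgain, ← lintegral_const_mul _ hGm]
    refine lintegral_mono fun y => mul_le_mul_left ((hb _).trans ?_) _
    rw [hmass, ← lintegral_const_mul _ (by fun_prop)]
    exact lintegral_mono fun p => (ENNReal.ofReal_mul (maxJacobian_pos γ).le).le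
  have ne_top_of : ∀ {I J : ENNReal}, sphereMeasure univ * I ≤ J → J ≠ ⊤ → I ≠ ⊤ := by
    rintro I J h hJ rfl
    rw [ENNReal.mul_top hμ0] at h
    exact hJ (top_le_iff.1 h)
  have hlf := ne_top_of hloss.le (ENNReal.mul_ne_top hmass_fin hL)
  have hgf := ne_top_of hup (ENNReal.mul_ne_top (ENNReal.mul_ne_top ENNReal.ofReal_ne_top
    hmass_fin) hL)
  have ml : AEStronglyMeasurable (fun q : CollisionSpace => (q.2 : ℝ) ^ γ * K (cosDev q) *
      g (preStar v q)) collisionMeasure := Measurable.aestronglyMeasurable (by fun_prop)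
  have mg : AEStronglyMeasurable (fun q : CollisionSpace => (q.2 : ℝ) ^ γ * K (cosDev q) *
      g (postStar v q)) collisionMeasure := Measurable.aestronglyMeasurable (by fun_prop)
  refine ⟨⟨ml, ?_⟩, ⟨mg, ?_⟩, ?_⟩
  · rw [hasFiniteIntegral_iff_ofReal (Eventually.of_forall (nn _))]
    exact hlf.lt_top
  · rw [hasFiniteIntegral_iff_ofReal (Eventually.of_forall (nn _))]
    exact hgf.lt_top
  · rw [integral_eq_lintegral_of_nonneg_ae (Eventually.of_forall (nn _)) ml,
      integral_eq_lintegral_of_nonneg_ae (Eventually.of_forall (nn _)) mg]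
    refine ENNReal.toReal_mono hgf ?_
    exact (ENNReal.mul_le_mul_iff_right hμ0 hμt).1 (hloss.le.trans hlow)

/-- The constant of the upper bound for the singular part. -/
noncomputable def singularConstant (γ s M : ℝ) : ℝ :=
  maxJacobian γ * (2 * M) * (24 * (2 + 2 * s) * (1 / (2 - 2 * s) + 1 / (2 * s)))

theorem lintegral_sphere_singular_le' {s : ℝ} (hs₀ : 0 < s) (hs₁ : s < 1) {A : ℝ} (hA : 0 ≤ A)
    (ω : S2) :
    ∫⁻ σ : S2, ENNReal.ofReal
        (‖(σ : R3) - ω‖ ^ (-2 - 2 * s) * min (A * ‖(σ : R3) - ω‖ ^ 2) 1) ∂sphereMeasure ≤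
      ENNReal.ofReal (24 * (2 + 2 * s) * (1 / (2 - 2 * s) + 1 / (2 * s)) * A ^ s) := by
  rcases hA.eq_or_lt with rfl | hA
  · simp
  · exact lintegral_sphere_singular_le hs₀ hs₁ hA ω

/-- In Carleman's variables the jump has length `|y| tan(θ/2)`, comparable to `|y| |σ - ω|`, so the
angular integral contributes `(B |y|²)^s` and raises the exponent `γ` to `γ + 2s`. The bound `M`
serves only for finiteness; the constant involves `M'` alone. -/
theorem lintegral_singular_le {γ s : ℝ} (hγ : -3 < γ) (hs₀ : 0 < s) (hs₁ : s < 1)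
    {K : ℝ → ℝ} (hKm : Measurable K)
    (hK0 : ∀ x, 0 ≤ K x) {M : ℝ} (hKM : ∀ x, K x ≤ M) (hKneg : ∀ x < 0, K x = 0)
    {M' : ℝ} (hM' : 0 ≤ M')
    (hKs : ∀ x, 0 ≤ x → x < 1 → K x ≤ 2 * M' * Real.sqrt (2 - 2 * x) ^ (-2 - 2 * s))
    {g : R3 → ℝ} (hg : Measurable g) {v : R3} {B : ℝ} (hB : 0 ≤ B) :
    ∫⁻ q : CollisionSpace, ENNReal.ofReal ((q.2 : ℝ) ^ γ * K (cosDev q) * g (postStar v q) *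
        min (B * ‖jump q‖ ^ 2) 1) ∂collisionMeasure ≤
      ENNReal.ofReal (singularConstant γ s M' * B ^ s) *
        ∫⁻ y, ENNReal.ofReal (‖y‖ ^ (γ + 2 * s) * g (v - y)) := by
  have hμ0 := sphereMeasure_univ_ne_zero
  have hμt : sphereMeasure univ ≠ ⊤ := measure_ne_top _ _
  -- `(1 - x)/(1 + x) = tan²(θ/2)`; the absolute value keeps `m` nonnegative for every real `x`.
  set m : ℝ → ℝ → ℝ := fun x u => min (B * (u ^ 2 * |(1 - x) / (1 + x)|)) 1 with hm
  have hmm : Measurable (Function.uncurry m) := by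
    unfold Function.uncurry
    fun_prop
  obtain ⟨hb, hgain⟩ := lintegral_gain hγ hKm hK0 hKM hKneg (m := m) hmm
    (fun x u => by simp only [hm]; positivity) (fun _ _ => min_le_right _ _) hg v
  have hleft : ∀ q : CollisionSpace, (q.2 : ℝ) ^ γ * K (cosDev q) * g (postStar v q) *
      min (B * ‖jump q‖ ^ 2) 1 = (q.2 : ℝ) ^ γ * K (cosDev q) * g (postStar v q) *
      m (cosDev q) (cosHalf (cosDev q) * q.2) := by
    intro q
    rcases lt_or_ge (cosDev q) 0 with hx | hx
    · simp [hKneg _ hx]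
    · congr 1
      have h1 : 0 ≤ 1 - cosDev q := by linarith [cosDev_le_one q]
      have h2 : cosHalf (cosDev q) ^ 2 = (1 + cosDev q) / 2 := Real.sq_sqrt (by linarith)
      simp only [hm]
      rw [norm_jump_sq, mul_pow, h2, abs_of_nonneg (by positivity)]
      congr 2
      field_simp
  have hmassle : ∀ u : ℝ, carlemanMass
      (fun x u => ENNReal.ofReal (K x * cosHalf x ^ (-γ) * m x u)) u ≤
      ENNReal.ofReal (singularConstant γ s M' * (B * u ^ 2) ^ s) * sphereMeasure univ := by
    intro u
    have hmj := maxJacobian_pos γ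
    calc _ ≤ _ := hb u
      _ ≤ ∫⁻ p : S2 × S2, ENNReal.ofReal (maxJacobian γ * (2 * M')) *
          ENNReal.ofReal (‖(p.2 : R3) - p.1‖ ^ (-2 - 2 * s) *
            min (B * u ^ 2 * ‖(p.2 : R3) - p.1‖ ^ 2) 1) ∂(sphereMeasure.prod sphereMeasure) := by
          refine lintegral_mono fun p => ?_
          rw [← ENNReal.ofReal_mul (by positivity)]
          rw [mul_assoc (maxJacobian γ)]
          refine ENNReal.ofReal_le_ofReal ?_
          set x : ℝ := inner ℝ (p.1 : R3) (p.2 : R3) with hx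
          have hd2 : ‖(p.2 : R3) - p.1‖ ^ 2 = 2 - 2 * x := by
            rw [norm_sub_sq_real, real_inner_comm]; simp; ring
          have hd : ‖(p.2 : R3) - p.1‖ = Real.sqrt (2 - 2 * x) := by
            rw [← hd2, Real.sqrt_sq (norm_nonneg _)]
          have hpos : 0 ≤ ‖(p.2 : R3) - p.1‖ ^ (-2 - 2 * s) := by positivity
          refine mul_le_mul_of_nonneg_left ?_ hmj.le
          rcases lt_or_ge x 0 with hx0 | hx0
          · rw [hKneg _ hx0, zero_mul]
            positivity
          rcases (inner_sphere_le_one p.1 p.2).eq_or_lt with hx1 | hx1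
          -- The kernel bound is not available at `x = 1`, but there the jump vanishes.
          · have : m x u = 0 := by
              rw [← hx] at hx1
              simp [hm, hx1]
            rw [this, mul_zero]
            positivity
          · rw [← hx] at hx1
            rw [← mul_assoc, hd2, hd]
            have hquot : |(1 - x) / (1 + x)| ≤ 2 - 2 * x := by
              rw [abs_of_nonneg (div_nonneg (by linarith) (by linarith)),
                div_le_iff₀ (by linarith)]
              nlinarith
            have hmle : m x u ≤ min (B * u ^ 2 * (2 - 2 * x)) 1 := by
              simp only [hm]
              rw [mul_assoc]
              gcongr
            exact mul_le_mul (hKs x hx0 hx1) hmle (by simp only [hm]; positivity)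
              (by positivity)
      _ ≤ ENNReal.ofReal (maxJacobian γ * (2 * M')) *
          (ENNReal.ofReal (24 * (2 + 2 * s) * (1 / (2 - 2 * s) + 1 / (2 * s)) * (B * u ^ 2) ^ s) *
            sphereMeasure univ) := by
          rw [lintegral_const_mul _ (by fun_prop)]
          gcongr
          rw [lintegral_prod _ (Measurable.aemeasurable (by fun_prop)), ← lintegral_const]
          exact lintegral_mono fun ω => lintegral_sphere_singular_le' hs₀ hs₁ (by positivity) ω
      _ = _ := by
          rw [← mul_assoc, ← ENNReal.ofReal_mul (by positivity), singularConstant]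
          congr 2
          ring
  rw [lintegral_congr fun q => by rw [hleft q]]
  refine (ENNReal.mul_le_mul_iff_right hμ0 hμt).1 ?_
  rw [hgain, ← mul_assoc, ← lintegral_const_mul _ (by fun_prop)]
  refine lintegral_mono fun y => ?_
  have hC : 0 ≤ singularConstant γ s M' := by
    have := maxJacobian_pos γ
    have : 0 < 2 - 2 * s := by linarith
    unfold singularConstant
    positivity
  calc _ ≤ ENNReal.ofReal (singularConstant γ s M' * (B * ‖y‖ ^ 2) ^ s) * sphereMeasure univ *
        ENNReal.ofReal (‖y‖ ^ γ * g (v - y)) := by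
        gcongr
        exact hmassle _
    _ = sphereMeasure univ * (ENNReal.ofReal (singularConstant γ s M' * (B * ‖y‖ ^ 2) ^ s) *
        ENNReal.ofReal (‖y‖ ^ γ * g (v - y))) := by ring
    _ ≤ sphereMeasure univ * (ENNReal.ofReal (singularConstant γ s M' * B ^ s) *
        ENNReal.ofReal (‖y‖ ^ (γ + 2 * s) * g (v - y))) := by
        refine mul_le_mul_right ?_ _
        rw [← ENNReal.ofReal_mul (by positivity), ← ENNReal.ofReal_mul (by positivity),
          Real.mul_rpow hB (by positivity), ← Real.rpow_natCast, ← Real.rpow_mul (norm_nonneg _)]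
        -- At `y = 0` the law of exponents fails, but the left side carries the factor `0^(2s) = 0`.
        rcases (norm_nonneg y).eq_or_lt with hy | hy
        · rw [← hy, Real.zero_rpow (by push_cast; positivity)]
          simp
        · refine le_of_eq (congrArg ENNReal.ofReal ?_)
          rw [add_comm γ, Real.rpow_add hy]
          push_cast
          ring
    _ = _ := by ring

/-- The collision integral is the singular part, with `g(v_*') (g(v') - g(v))`, plus `g(v)` times
gain minus loss. The latter is nonnegative; the former is averaged with its mirror image under
exchange of the two directions and estimated through second differences. -/
theorem integral_collision_ge {γ s : ℝ} (hγ : -3 < γ) (hs₀ : 0 < s) (hs₁ : s < 1)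
    {K : ℝ → ℝ} (hKm : Measurable K)
    (hK0 : ∀ x, 0 ≤ K x) {M : ℝ} (hKM : ∀ x, K x ≤ M) (hKneg : ∀ x < 0, K x = 0)
    {M' : ℝ} (hM' : 0 ≤ M')
    (hKs : ∀ x, 0 ≤ x → x < 1 → K x ≤ 2 * M' * Real.sqrt (2 - 2 * x) ^ (-2 - 2 * s))
    {g : R3 → ℝ} (hg : Measurable g) (hg0 : ∀ w, 0 ≤ g w) {v : R3}
    (hL : ∫⁻ y, ENNReal.ofReal (‖y‖ ^ γ * g (v - y)) ≠ ⊤)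
    {B δ I : ℝ} (hB : 0 ≤ B) (hδ : 0 ≤ δ) (hI0 : 0 ≤ I)
    (hI : ∫⁻ y, ENNReal.ofReal (‖y‖ ^ (γ + 2 * s) * g (v - y)) ≤ ENNReal.ofReal I)
    (hsec : ∀ h, -2 * δ * min (B * ‖h‖ ^ 2) 1 ≤ g (v + h) + g (v - h) - 2 * g v)
    (hint : Integrable (fun q : CollisionSpace => (q.2 : ℝ) ^ γ * K (cosDev q) *
      (g (postStar v q) * g (v + jump q) - g (preStar v q) * g v)) collisionMeasure) :
    -(δ * (singularConstant γ s M' * B ^ s * I)) ≤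
      ∫ q : CollisionSpace, (q.2 : ℝ) ^ γ * K (cosDev q) *
        (g (postStar v q) * g (v + jump q) - g (preStar v q) * g v) ∂collisionMeasure := by
  obtain ⟨il, ig, hle⟩ := integrable_loss_gain hγ hKm hK0 hKM hKneg hg hg0 hL
  have hC : 0 ≤ singularConstant γ s M' := by
    have := maxJacobian_pos γ
    have : 0 < 2 - 2 * s := by linarith
    unfold singularConstant
    positivity
  have nn : ∀ q : CollisionSpace, 0 ≤ (q.2 : ℝ) ^ γ * K (cosDev q) * g (postStar v q) := fun q =>
    mul_nonneg (mul_nonneg (Real.rpow_nonneg (le_of_lt q.2.2) _) (hK0 _)) (hg0 _)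
  -- the singular part
  have hD : Integrable (fun q : CollisionSpace => (q.2 : ℝ) ^ γ * K (cosDev q) *
      g (postStar v q) * (g (v + jump q) - g v)) collisionMeasure := by
    have := (hint.add (il.mul_const (g v))).sub (ig.mul_const (g v))
    refine this.congr (Eventually.of_forall fun q => ?_)
    simp only [Pi.add_apply, Pi.sub_apply]
    ring
  have hdecomp : ∫ q : CollisionSpace, (q.2 : ℝ) ^ γ * K (cosDev q) *
        (g (postStar v q) * g (v + jump q) - g (preStar v q) * g v) ∂collisionMeasure =
      ∫ q : CollisionSpace, (q.2 : ℝ) ^ γ * K (cosDev q) *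
      g (postStar v q) * (g (v + jump q) - g v) ∂collisionMeasure +
      g v * (∫ q : CollisionSpace, (q.2 : ℝ) ^ γ * K (cosDev q) * g (postStar v q)
        ∂collisionMeasure - ∫ q : CollisionSpace, (q.2 : ℝ) ^ γ * K (cosDev q) * g (preStar v q)
        ∂collisionMeasure) := by
    have hdiff : Integrable (fun q : CollisionSpace => g v * ((q.2 : ℝ) ^ γ * K (cosDev q) *
        g (postStar v q) - (q.2 : ℝ) ^ γ * K (cosDev q) * g (preStar v q))) collisionMeasure :=
      (ig.sub il).const_mul _
    rw [← integral_sub ig il, ← integral_const_mul, ← integral_add hD hdiff]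
    refine integral_congr_ae (Eventually.of_forall fun q => ?_)
    simp only
    ring
  have hswap_fun : (fun q : CollisionSpace => (q.2 : ℝ) ^ γ * K (cosDev q) *
      g (postStar v q) * (g (v - jump q) - g v)) = fun q : CollisionSpace =>
      (fun q : CollisionSpace => (q.2 : ℝ) ^ γ * K (cosDev q) *
      g (postStar v q) * (g (v + jump q) - g v)) ((q.1.2, q.1.1), q.2) := by
    funext q
    have h1 : cosDev ((q.1.2, q.1.1), q.2) = cosDev q := real_inner_comm _ _
    have h2 : postStar v ((q.1.2, q.1.1), q.2) = postStar v q := by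
      simp only [postStar, add_comm]
    have h3 : v + jump ((q.1.2, q.1.1), q.2) = v - jump q := by
      simp only [jump]
      module
    simp only [h1, h2, h3]
  have hD' : Integrable (fun q : CollisionSpace => (q.2 : ℝ) ^ γ * K (cosDev q) *
      g (postStar v q) * (g (v - jump q) - g v)) collisionMeasure := by
    rw [hswap_fun]
    exact measurePreserving_swapSpheres.integrable_comp_of_integrable hD
  have hswap : ∫ q : CollisionSpace, (q.2 : ℝ) ^ γ * K (cosDev q) *
      g (postStar v q) * (g (v - jump q) - g v) ∂collisionMeasure =
      ∫ q : CollisionSpace, (q.2 : ℝ) ^ γ * K (cosDev q) *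
      g (postStar v q) * (g (v + jump q) - g v) ∂collisionMeasure := by
    rw [hswap_fun]
    exact integral_comp_measurePreserving measurePreserving_swapSpheres hD.aestronglyMeasurable
  have nnm : ∀ q : CollisionSpace, 0 ≤ (q.2 : ℝ) ^ γ * K (cosDev q) * g (postStar v q) *
      min (B * ‖jump q‖ ^ 2) 1 := fun q => mul_nonneg (nn q) (by positivity)
  have mm : AEStronglyMeasurable (fun q : CollisionSpace => (q.2 : ℝ) ^ γ * K (cosDev q) *
      g (postStar v q) * min (B * ‖jump q‖ ^ 2) 1) collisionMeasure :=
    Measurable.aestronglyMeasurable (by fun_prop)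
  have hm : Integrable (fun q : CollisionSpace => (q.2 : ℝ) ^ γ * K (cosDev q) *
      g (postStar v q) * min (B * ‖jump q‖ ^ 2) 1) collisionMeasure := by
    refine ig.mono' mm (Eventually.of_forall fun q => ?_)
    rw [Real.norm_of_nonneg (nnm q)]
    exact mul_le_of_le_one_right (nn q) (min_le_right _ _)
  have hmle : ∫ q : CollisionSpace, (q.2 : ℝ) ^ γ * K (cosDev q) *
      g (postStar v q) * min (B * ‖jump q‖ ^ 2) 1 ∂collisionMeasure ≤
      singularConstant γ s M' * B ^ s * I := by
    rw [integral_eq_lintegral_of_nonneg_ae (Eventually.of_forall nnm) mm]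
    refine ENNReal.toReal_le_of_le_ofReal (by positivity) ?_
    refine (lintegral_singular_le hγ hs₀ hs₁ hKm hK0 hKM hKneg hM' hKs hg hB).trans ?_
    rw [ENNReal.ofReal_mul (p := singularConstant γ s M' * B ^ s) (by positivity)]
    gcongr
  have hlow : -2 * δ * ∫ q : CollisionSpace, (q.2 : ℝ) ^ γ * K (cosDev q) *
      g (postStar v q) * min (B * ‖jump q‖ ^ 2) 1 ∂collisionMeasure ≤
      ∫ q : CollisionSpace, (q.2 : ℝ) ^ γ * K (cosDev q) *
      g (postStar v q) * (g (v + jump q) - g v) ∂collisionMeasure +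
      ∫ q : CollisionSpace, (q.2 : ℝ) ^ γ * K (cosDev q) *
      g (postStar v q) * (g (v - jump q) - g v) ∂collisionMeasure := by
    rw [← integral_const_mul, ← integral_add hD hD']
    refine integral_mono (hm.const_mul _) (hD.add hD') fun q => ?_
    have := mul_le_mul_of_nonneg_left (hsec (jump q)) (nn q)
    simp only
    linarith
  rw [hswap] at hlow
  have h1 : 0 ≤ g v * (∫ q : CollisionSpace, (q.2 : ℝ) ^ γ * K (cosDev q) * g (postStar v q)
        ∂collisionMeasure - ∫ q : CollisionSpace, (q.2 : ℝ) ^ γ * K (cosDev q) * g (preStar v q)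
        ∂collisionMeasure) := mul_nonneg (hg0 _) (sub_nonneg.2 hle)
  have h2 := mul_le_mul_of_nonneg_left hmle hδ
  rw [hdecomp]
  linarith

/-! ### The cut-off kernel and the principal value. -/

/-- The angular part of the kernel, cut off at `θ ≤ ε`, as a function of `cos θ`. -/
noncomputable def angularKernel (s : ℝ) (b : ℝ → ℝ) (ε x : ℝ) : ℝ :=
  if ε < Real.arccos x then Real.arccos x ^ (-2 - 2 * s) * b (Real.cos (Real.arccos x)) else 0

theorem measurable_angularKernel (s : ℝ) {b : ℝ → ℝ} (hb : Measurable b) (ε : ℝ) :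
    Measurable (angularKernel s b ε) := by
  have h := Real.measurable_arccos
  refine Measurable.ite (measurableSet_lt measurable_const h) ?_ measurable_const
  exact (h.pow_const _).mul (hb.comp (Real.measurable_cos.comp h))

theorem angularKernel_nonneg (s : ℝ) {b : ℝ → ℝ} (hb : IsAngularFunction b) (ε x : ℝ) :
    0 ≤ angularKernel s b ε x := by
  unfold angularKernel
  split_ifs
  · exact mul_nonneg (Real.rpow_nonneg (Real.arccos_nonneg _) _)
      (hb.pos _ ⟨Real.neg_one_le_cos _, Real.cos_le_one _⟩).le
  · rfl

theorem angularKernel_le {s : ℝ} {b : ℝ → ℝ} {M : ℝ} (hM : ∀ c ∈ Icc (-1 : ℝ) 1, b c ≤ M)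
    (hM0 : 0 ≤ M) (ε x : ℝ) :
    angularKernel s b ε x ≤ M * Real.arccos x ^ (-2 - 2 * s) := by
  have h0 := Real.rpow_nonneg (Real.arccos_nonneg x) (-2 - 2 * s)
  unfold angularKernel
  split_ifs
  · rw [mul_comm]
    exact mul_le_mul_of_nonneg_right (hM _ ⟨Real.neg_one_le_cos _, Real.cos_le_one _⟩) h0
  · positivity

theorem angularKernel_le_const {s : ℝ} (hs₀ : 0 < s) {b : ℝ → ℝ} {M : ℝ}
    (hM : ∀ c ∈ Icc (-1 : ℝ) 1, b c ≤ M)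
    (hM0 : 0 ≤ M) {ε : ℝ} (hε : 0 < ε) (x : ℝ) :
    angularKernel s b ε x ≤ M * ε ^ (-2 - 2 * s) := by
  by_cases hx : ε < Real.arccos x
  · refine (angularKernel_le hM hM0 ε x).trans ?_
    exact mul_le_mul_of_nonneg_left
      (Real.rpow_le_rpow_of_nonpos hε hx.le (by linarith)) hM0
  · rw [angularKernel, if_neg hx]
    positivity

/-- The chord `√(2 - 2x)` is at most the angle `arccos x`, which for `x ≥ 0` is at most `arccos
(-x)`; each half of the fold thus obeys the same bound, uniformly in `ε`. -/
theorem foldKernel_angularKernel_le {s : ℝ} (hs₀ : 0 < s) {b : ℝ → ℝ} {M : ℝ}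
    (hM : ∀ c ∈ Icc (-1 : ℝ) 1, b c ≤ M) (hM0 : 0 ≤ M) (ε : ℝ) {x : ℝ} (hx : 0 ≤ x)
    (hx1 : x < 1) :
    foldKernel (angularKernel s b ε) x ≤ 2 * M * Real.sqrt (2 - 2 * x) ^ (-2 - 2 * s) := by
  have hs : 0 < Real.sqrt (2 - 2 * x) := Real.sqrt_pos.2 (by linarith)
  have h1 : Real.sqrt (2 - 2 * x) ≤ Real.arccos x := by
    refine Real.sqrt_le_iff.2 ⟨Real.arccos_nonneg _, ?_⟩
    have := Real.one_sub_sq_div_two_le_cos (x := Real.arccos x)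
    rw [Real.cos_arccos (by linarith) hx1.le] at this
    linarith
  have h2 : Real.arccos x ≤ Real.arccos (-x) := Real.antitone_arccos (by linarith)
  have k1 : angularKernel s b ε x ≤ M * Real.sqrt (2 - 2 * x) ^ (-2 - 2 * s) :=
    (angularKernel_le hM hM0 ε x).trans (mul_le_mul_of_nonneg_left
      (Real.rpow_le_rpow_of_nonpos hs h1 (by linarith)) hM0)
  have k2 : angularKernel s b ε (-x) ≤ M * Real.sqrt (2 - 2 * x) ^ (-2 - 2 * s) :=
    (angularKernel_le hM hM0 ε (-x)).trans (mul_le_mul_of_nonneg_left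
      (Real.rpow_le_rpow_of_nonpos hs (h1.trans h2) (by linarith)) hM0)
  have k0 : 0 ≤ M * Real.sqrt (2 - 2 * x) ^ (-2 - 2 * s) := by positivity
  unfold foldKernel
  split_ifs <;> linarith

theorem measurableSet_nonGrazing (v : R3) (ε : ℝ) : MeasurableSet (nonGrazing v ε) := by
  have : Measurable fun q : R3 × S2 => deviationAngle v q.1 q.2 := by
    unfold deviationAngle InnerProductGeometry.angle
    exact Real.measurable_arccos.comp (by fun_prop)
  exact measurableSet_lt measurable_const this

theorem deviationAngle_preStar (v : R3) (q : CollisionSpace) :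
    deviationAngle v (preStar v q) q.1.2 = Real.arccos (cosDev q) := by
  rw [deviationAngle, preStar, sub_sub_cancel, InnerProductGeometry.angle_smul_left_of_pos _ _ q.2.2,
    InnerProductGeometry.angle, cosDev]
  simp

theorem indicator_collisionIntegrand (γ s : ℝ) (b : ℝ → ℝ) (g : R3 → ℝ) (v : R3) (ε : ℝ)
    (q : CollisionSpace) :
    (nonGrazing v ε).indicator (collisionIntegrand γ s b g v) (preStar v q, q.1.2) =
      (q.2 : ℝ) ^ γ * angularKernel s b ε (cosDev q) *
        (g (postStar v q) * g (v + jump q) - g (preStar v q) * g v) := by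
  have ht : (0 : ℝ) < q.2 := q.2.2
  have hn : ‖v - preStar v q‖ = q.2 := by
    rw [preStar, sub_sub_cancel, norm_smul, Real.norm_of_nonneg ht.le]
    simp
  have h1 : vsPrime v (preStar v q) q.1.2 = postStar v q := by
    rw [vsPrime, hn, preStar, postStar]
    module
  have h2 : vPrime v (preStar v q) q.1.2 = v + jump q := by
    rw [vPrime, hn, preStar, jump]
    module
  by_cases hq : ε < Real.arccos (cosDev q)
  · rw [indicator_of_mem (by rw [nonGrazing, mem_ofPred_eq, deviationAngle_preStar]; exact hq),
      collisionIntegrand, collisionKernel, deviationAngle_preStar, hn, h1, h2, angularKernel,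
      if_pos hq]
    ring
  · rw [indicator_of_notMem (by rw [nonGrazing, mem_ofPred_eq, deviationAngle_preStar]; exact hq),
      angularKernel, if_neg hq]
    ring

/-- Lower bound for the collision operator at a point where the second differences of `g` are
bounded below. -/
theorem collision_ge {γ s : ℝ} (hγ : -3 < γ) (hs₀ : 0 < s) (hs₁ : s < 1)
    {b : ℝ → ℝ} (hb : IsAngularFunction b) {M : ℝ} (hM : ∀ c ∈ Icc (-1 : ℝ) 1, b c ≤ M)
    {g : R3 → ℝ} (hg : Measurable g) (hg0 : ∀ w, 0 ≤ g w) {v : R3}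
    (hL : ∫⁻ y, ENNReal.ofReal (‖y‖ ^ γ * g (v - y)) ≠ ⊤)
    {B δ I : ℝ} (hB : 0 ≤ B) (hδ : 0 ≤ δ) (hI0 : 0 ≤ I)
    (hI : ∫⁻ y, ENNReal.ofReal (‖y‖ ^ (γ + 2 * s) * g (v - y)) ≤ ENNReal.ofReal I)
    (hsec : ∀ h, -2 * δ * min (B * ‖h‖ ^ 2) 1 ≤ g (v + h) + g (v - h) - 2 * g v)
    {Q : ℝ} (hQ : HasCollisionValue γ s b g v Q) :
    -(δ * (singularConstant γ s M * B ^ s * I)) ≤ Q := by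
  have hM0 : 0 ≤ M := (hb.pos 0 (by norm_num)).le.trans (hM 0 (by norm_num))
  refine ge_of_tendsto hQ.2 ?_
  filter_upwards [self_mem_nhdsWithin] with ε hε
  have hε : 0 < ε := hε
  have hmp := measurePreserving_collisionPolar v
  have hint := (integrable_indicator_iff (measurableSet_nonGrazing v ε)).2 (hQ.1 ε hε)
  have hint' : Integrable (fun q : CollisionSpace => (q.2 : ℝ) ^ γ *
      angularKernel s b ε (cosDev q) *
        (g (postStar v q) * g (v + jump q) - g (preStar v q) * g v)) collisionMeasure := by
    simp only [← indicator_collisionIntegrand]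
    exact hmp.integrable_comp_of_integrable hint
  obtain ⟨hfold, hfold'⟩ := integral_fold hint'
  have hn := angularKernel_nonneg s hb ε
  -- The crude bound `M ε^(-2-2s)` on the kernel depends on `ε`, but the resulting lower bound does
  -- not, so it passes to the limit.
  have := integral_collision_ge hγ hs₀ hs₁
    (measurable_foldKernel (measurable_angularKernel s hb.measurable ε))
    (foldKernel_nonneg hn) (foldKernel_le hn (angularKernel_le_const hs₀ hM hM0 hε))
    (fun x hx => foldKernel_of_neg _ hx) hM0
    (fun x hx hx1 => foldKernel_angularKernel_le hs₀ hM hM0 ε hx hx1) hg hg0 hL hB hδ hI0 hI hsec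
    hfold
  rw [hfold'] at this
  refine this.trans_eq ?_
  rw [← integral_indicator (measurableSet_nonGrazing v ε),
    ← integral_comp_measurePreserving hmp hint.aestronglyMeasurable]
  exact integral_congr_ae (Eventually.of_forall fun q =>
    (indicator_collisionIntegrand γ s b g v ε q).symm)

/-! ### Convolution with a power of the distance. -/

theorem lintegral_ball_rpow_lt_top {a : ℝ} (ha : -3 < a) :
    ∫⁻ y in Metric.ball (0 : R3) 1, ENNReal.ofReal (‖y‖ ^ a) < ⊤ := by
  have h : IntegrableOn (fun y : R3 => ‖y‖ ^ a) (Metric.ball (0 : R3) 1) := by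
    rw [integrableOn_fun_norm_addHaar (volume : Measure R3) (f := fun t => t ^ a)]
    have h1 := (intervalIntegral.intervalIntegrable_rpow' (a := 0) (b := 1)
      (r := a + 2) (by linarith))
    rw [intervalIntegrable_iff_integrableOn_Ioo_of_le zero_le_one] at h1
    refine h1.congr_fun (fun t ht => ?_) measurableSet_Ioo
    simp only [finrank_euclideanSpace, Fintype.card_fin, smul_eq_mul]
    rw [Real.rpow_add ht.1, mul_comm]
    norm_num
  have := h.2
  rwa [hasFiniteIntegral_iff_ofReal (Eventually.of_forall fun y => by positivity)] at this

theorem lintegral_rpow_mul_le_ball_add {a : ℝ} (ha : a ≤ 0) {g : R3 → ℝ}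
    (hg0 : ∀ w, 0 ≤ g w) (v : R3) :
    ∫⁻ y, ENNReal.ofReal (‖y‖ ^ a * g (v - y)) ≤
      (∫⁻ y in Metric.ball (0 : R3) 1, ENNReal.ofReal (‖y‖ ^ a * g (v - y))) +
        ∫⁻ w, ENNReal.ofReal (g w) := by
  rw [← lintegral_add_compl _ (Metric.isOpen_ball (x := (0 : R3)) (ε := 1)).measurableSet]
  refine add_le_add le_rfl ?_
  calc _ ≤ ∫⁻ y in (Metric.ball (0 : R3) 1)ᶜ, ENNReal.ofReal (g (v - y)) := by
        refine setLIntegral_mono' Metric.isOpen_ball.measurableSet.compl fun y hy => ?_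
        refine ENNReal.ofReal_le_ofReal (mul_le_of_le_one_left (hg0 _) ?_)
        refine Real.rpow_le_one_of_one_le_of_nonpos ?_ ha
        simpa using hy
    _ ≤ ∫⁻ y, ENNReal.ofReal (g (v - y)) := setLIntegral_le_lintegral _ _
    _ = _ := lintegral_sub_left_eq_self (fun w => ENNReal.ofReal (g w)) v

/-- Hölder's inequality: `p > 3/(3 + a)` says exactly that `|y|^a` belongs to `L^q` of the unit ball
for the conjugate exponent `q`. The constant is this `L^q` norm. -/
theorem exists_lintegral_ball_rpow_mul_le_eLpNorm {a : ℝ} (ha : -3 < a) (ha0 : a < 0)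
    {p : ENNReal} (hp : ENNReal.ofReal (3 / (3 + a)) < p) :
    ∃ N : ℝ, 0 ≤ N ∧ ∀ (g : R3 → ℝ), Measurable g → ∀ v : R3,
      ∫⁻ y in Metric.ball (0 : R3) 1, ENNReal.ofReal (‖y‖ ^ a * g (v - y)) ≤
        ENNReal.ofReal N * eLpNorm g p volume := by
  have hp1 : 1 ≤ p := by
    refine le_trans ?_ hp.le
    rw [ENNReal.one_le_ofReal, le_div_iff₀ (by linarith)]
    linarith
  set q := ENNReal.conjExponent p with hq
  have hpq : ENNReal.HolderConjugate p q := ENNReal.HolderConjugate.conjExponent hp1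
  have hqp : ENNReal.HolderTriple q p 1 := hpq.symm
  have hsum : (p⁻¹).toReal + (q⁻¹).toReal = 1 := by
    have h := hpq.inv_add_inv_eq_inv
    have hpt : p⁻¹ ≠ ⊤ := ENNReal.inv_ne_top.2 (by positivity)
    have hqt : q⁻¹ ≠ ⊤ := by
      intro hh
      rw [hh] at h
      simp at h
    rw [← ENNReal.toReal_add hpt hqt, h]
    simp
  have hplt : (p⁻¹).toReal < (3 + a) / 3 := by
    have h1 : p⁻¹ < ENNReal.ofReal ((3 + a) / 3) := by
      rw [← inv_div, ENNReal.ofReal_inv_of_pos (by apply div_pos <;> linarith)]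
      exact ENNReal.inv_lt_inv.2 hp
    exact (ENNReal.lt_ofReal_iff_toReal_lt h1.ne_top).1 h1
  have hq' : -a / 3 < (q⁻¹).toReal := by linarith
  have hqpos : 0 < (q⁻¹).toReal := lt_trans (by linarith) hq'
  have hq0 : q ≠ 0 := by
    rintro h
    simp [h] at hqpos
  have hqt : q ≠ ⊤ := by
    rintro h
    simp [h] at hqpos
  have hqr : 0 < q.toReal := ENNReal.toReal_pos hq0 hqt
  have haq : -3 < a * q.toReal := by
    rw [ENNReal.toReal_inv, lt_inv_comm₀ (by linarith) hqr, inv_div, lt_div_iff₀ (by linarith)]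
      at hq'
    linarith
  set φ : R3 → ℝ := (Metric.ball (0 : R3) 1).indicator fun y => ‖y‖ ^ a with hφ
  have hball : MeasurableSet (Metric.ball (0 : R3) 1) := Metric.isOpen_ball.measurableSet
  have hφm : Measurable φ := Measurable.indicator (by fun_prop) hball
  have hφfin : eLpNorm φ q volume < ⊤ := by
    rw [eLpNorm_lt_top_iff_lintegral_rpow_enorm_lt_top hq0 hqt]
    refine lt_of_eq_of_lt ?_ (lintegral_ball_rpow_lt_top haq)
    rw [← lintegral_indicator hball]
    refine lintegral_congr fun y => ?_
    by_cases hy : y ∈ Metric.ball (0 : R3) 1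
    · rw [indicator_of_mem hy, hφ, indicator_of_mem hy, Real.enorm_eq_ofReal (by positivity),
        ENNReal.ofReal_rpow_of_nonneg (by positivity) hqr.le, Real.rpow_mul (norm_nonneg _)]
    · rw [indicator_of_notMem hy, hφ, indicator_of_notMem hy, enorm_zero,
        ENNReal.zero_rpow_of_pos hqr]
  refine ⟨(eLpNorm φ q volume).toReal, ENNReal.toReal_nonneg, fun g hg v => ?_⟩
  rw [ENNReal.ofReal_toReal hφfin.ne]
  have hmp := Measure.measurePreserving_sub_left (volume : Measure R3) v
  rw [← eLpNorm_comp_measurePreserving hg.aestronglyMeasurable hmp]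
  refine le_trans ?_ (eLpNorm_smul_le_mul_eLpNorm (p := q) (q := p) (r := 1)
    (hg.comp hmp.measurable).aestronglyMeasurable hφm.aestronglyMeasurable)
  rw [eLpNorm_one_eq_lintegral_enorm, ← lintegral_indicator hball]
  refine lintegral_mono fun y => ?_
  by_cases hy : y ∈ Metric.ball (0 : R3) 1
  · rw [indicator_of_mem hy]
    simp only [Pi.smul_apply', hφ, indicator_of_mem hy, smul_eq_mul, Function.comp]
    exact Real.ofReal_le_enorm _
  · rw [indicator_of_notMem hy]
    exact zero_le

theorem rpow_norm_sub_le {a m : ℝ} (ha : 0 ≤ a) (ham : a ≤ m) (v w : R3) :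
    ‖v - w‖ ^ a ≤ (2 * (1 + ‖v‖)) ^ a * (1 + ‖w‖ ^ m) := by
  have h1 : ‖v - w‖ ≤ (1 + ‖v‖) * (1 + ‖w‖) := by
    nlinarith [norm_sub_le v w, norm_nonneg v, norm_nonneg w,
      mul_nonneg (norm_nonneg v) (norm_nonneg w)]
  have h2 : (1 + ‖w‖) ^ a ≤ 2 ^ a * (1 + ‖w‖ ^ m) := by
    have hm : 0 ≤ ‖w‖ ^ m := by positivity
    rcases le_total ‖w‖ 1 with hw | hw
    · calc (1 + ‖w‖) ^ a ≤ 2 ^ a := by gcongr; linarith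
        _ ≤ _ := le_mul_of_one_le_right (by positivity) (by linarith)
    · calc (1 + ‖w‖) ^ a ≤ (2 * ‖w‖) ^ a := by gcongr; linarith
        _ = 2 ^ a * ‖w‖ ^ a := Real.mul_rpow (by norm_num) (norm_nonneg _)
        _ ≤ 2 ^ a * (1 + ‖w‖ ^ m) := by
          gcongr
          linarith [Real.rpow_le_rpow_of_exponent_le hw ham]
  calc ‖v - w‖ ^ a ≤ ((1 + ‖v‖) * (1 + ‖w‖)) ^ a := by gcongr
    _ = (1 + ‖v‖) ^ a * (1 + ‖w‖) ^ a := Real.mul_rpow (by positivity) (by positivity)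
    _ ≤ (1 + ‖v‖) ^ a * (2 ^ a * (1 + ‖w‖ ^ m)) := by gcongr
    _ = _ := by rw [Real.mul_rpow (by norm_num) (by positivity)]; ring

theorem lintegral_rpow_mul_le_moment {a m : ℝ} (ha : 0 ≤ a) (ham : a ≤ m) {g : R3 → ℝ}
    (hg0 : ∀ w, 0 ≤ g w) (hint : Integrable fun w : R3 => (1 + ‖w‖ ^ m) * g w) (v : R3) :
    ∫⁻ y, ENNReal.ofReal (‖y‖ ^ a * g (v - y)) ≤
      ENNReal.ofReal ((2 * (1 + ‖v‖)) ^ a * ∫ w : R3, (1 + ‖w‖ ^ m) * g w) := by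
  have h0 : ∀ w : R3, 0 ≤ (1 + ‖w‖ ^ m) * g w := fun w => mul_nonneg (by positivity) (hg0 w)
  rw [← lintegral_sub_left_eq_self _ v, ENNReal.ofReal_mul (by positivity),
    ofReal_integral_eq_lintegral_ofReal hint (Eventually.of_forall h0),
    ← lintegral_const_mul' _ _ ENNReal.ofReal_ne_top]
  refine lintegral_mono fun w => ?_
  rw [← ENNReal.ofReal_mul (by positivity)]
  refine ENNReal.ofReal_le_ofReal ?_
  rw [sub_sub_cancel, ← mul_assoc]
  exact mul_le_mul_of_nonneg_right (rpow_norm_sub_le ha ham v w) (hg0 w)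

theorem lintegral_ofReal_le_moment {m : ℝ} {g : R3 → ℝ}
    (hg0 : ∀ w, 0 ≤ g w) (hint : Integrable fun w : R3 => (1 + ‖w‖ ^ m) * g w) :
    ∫⁻ w, ENNReal.ofReal (g w) ≤ ENNReal.ofReal (∫ w : R3, (1 + ‖w‖ ^ m) * g w) := by
  have h0 : ∀ w : R3, 0 ≤ (1 + ‖w‖ ^ m) * g w := fun w => mul_nonneg (by positivity) (hg0 w)
  rw [ofReal_integral_eq_lintegral_ofReal hint (Eventually.of_forall h0)]
  refine lintegral_mono fun w => ENNReal.ofReal_le_ofReal ?_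
  exact le_mul_of_one_le_left (hg0 w) (by linarith [Real.rpow_nonneg (norm_nonneg w) m])

/-- Finiteness only, with continuity of `g` bounding it near the singularity. It is applied with
exponent `γ`, for which the `L^p` hypothesis may be too weak and no uniform bound is needed. -/
theorem lintegral_rpow_mul_ne_top {a m : ℝ} (ha : -3 < a) (ham : a ≤ m) {g : R3 → ℝ}
    (hg : Continuous g) (hg0 : ∀ w, 0 ≤ g w)
    (hint : Integrable fun w : R3 => (1 + ‖w‖ ^ m) * g w) (v : R3) :
    ∫⁻ y, ENNReal.ofReal (‖y‖ ^ a * g (v - y)) ≠ ⊤ := by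
  rcases le_total 0 a with ha0 | ha0
  · exact ((lintegral_rpow_mul_le_moment ha0 ham hg0 hint v).trans_lt ENNReal.ofReal_lt_top).ne
  obtain ⟨D, hD⟩ := ((isCompact_closedBall (0 : R3) 1).image
    (f := fun y => g (v - y)) (by fun_prop)).bddAbove
  refine ((lintegral_rpow_mul_le_ball_add ha0 hg0 v).trans_lt
    (ENNReal.add_lt_top.2 ⟨?_, (lintegral_ofReal_le_moment hg0 hint).trans_lt
      ENNReal.ofReal_lt_top⟩)).ne
  calc _ ≤ ∫⁻ y in Metric.ball (0 : R3) 1, ENNReal.ofReal (‖y‖ ^ a) * ENNReal.ofReal D := by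
        refine setLIntegral_mono' Metric.isOpen_ball.measurableSet fun y hy => ?_
        rw [← ENNReal.ofReal_mul (by positivity)]
        refine ENNReal.ofReal_le_ofReal (mul_le_mul_of_nonneg_left ?_ (by positivity))
        exact hD ⟨y, Metric.ball_subset_closedBall hy, rfl⟩
    _ < ⊤ := by
        rw [lintegral_mul_const' _ _ ENNReal.ofReal_ne_top]
        exact ENNReal.mul_lt_top (lintegral_ball_rpow_lt_top ha) ENNReal.ofReal_lt_top

/-- The convolution of `g` with `|·| ^ a` is controlled by the zeroth-order bounds. -/
theorem exists_lintegral_rpow_mul_le {a : ℝ} (ha : -3 < a) (K₀ : ℝ) (p : ENNReal) (P₀ : ℝ)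
    (hp : a < 0 → ENNReal.ofReal (3 / (3 + a)) < p) :
    ∃ C : ℝ, 0 < C ∧ ∀ g : R3 → ℝ, Continuous g → (∀ w, 0 ≤ g w) →
      (Integrable fun w : R3 => (1 + ‖w‖ ^ max 2 a) * g w) →
      ∫ w : R3, (1 + ‖w‖ ^ max 2 a) * g w ≤ K₀ →
      (a < 0 → eLpNorm g p volume ≤ ENNReal.ofReal P₀) → ∀ v : R3,
        ∫⁻ y, ENNReal.ofReal (‖y‖ ^ a * g (v - y)) ≤
          ENNReal.ofReal (C * (1 + ‖v‖) ^ max a 0) := by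
  rcases le_or_gt 0 a with ha0 | ha0
  · refine ⟨2 ^ a * |K₀| + 1, by positivity, fun g _ hg0 hint hK _ v => ?_⟩
    refine (lintegral_rpow_mul_le_moment ha0 (le_max_right 2 a) hg0 hint v).trans
      (ENNReal.ofReal_le_ofReal ?_)
    rw [max_eq_left ha0, Real.mul_rpow (by norm_num) (by positivity)]
    have h1 : 0 ≤ (1 + ‖v‖) ^ a := by positivity
    calc _ ≤ 2 ^ a * (1 + ‖v‖) ^ a * |K₀| := by
          gcongr
          exact hK.trans (le_abs_self _)
      _ ≤ _ := by nlinarith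
  · obtain ⟨N, hN0, hN⟩ := exists_lintegral_ball_rpow_mul_le_eLpNorm ha ha0 (hp ha0)
    refine ⟨N * |P₀| + |K₀| + 1, by positivity, fun g hg hg0 hint hK hP v => ?_⟩
    rw [max_eq_right ha0.le, Real.rpow_zero, mul_one]
    refine (lintegral_rpow_mul_le_ball_add ha0.le hg0 v).trans ?_
    calc _ ≤ ENNReal.ofReal (N * |P₀|) + ENNReal.ofReal |K₀| := by
          refine add_le_add ?_ ?_
          · refine (hN g hg.measurable v).trans ?_
            rw [ENNReal.ofReal_mul hN0]
            gcongr
            exact (hP ha0).trans (ENNReal.ofReal_le_ofReal (le_abs_self _))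
          · exact (lintegral_ofReal_le_moment hg0 hint).trans
              (ENNReal.ofReal_le_ofReal (hK.trans (le_abs_self _)))
      _ ≤ _ := by
          rw [← ENNReal.ofReal_add (by positivity) (by positivity)]
          exact ENNReal.ofReal_le_ofReal (by linarith)

/-! ### The barrier and its derivatives. -/

/-- The squared distance to `(x₀, v₀)`, transported by the free flow. -/
noncomputable def transportedDist (x₀ v₀ : R3) (r ρ t : ℝ) (x v : R3) : ℝ :=
  ‖v - v₀‖ ^ 2 / ρ ^ 2 + ‖x - x₀ - t • v‖ ^ 2 / r ^ 2

/-- A subsolution moving with the free flow and decreasing at rate `δ l`. -/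
noncomputable def barrier (x₀ v₀ : R3) (r ρ δ l t : ℝ) (x v : R3) : ℝ :=
  δ * (1 - transportedDist x₀ v₀ r ρ t x v - l * t)

theorem transportedDist_nonneg (x₀ v₀ : R3) (r ρ t : ℝ) (x v : R3) :
    0 ≤ transportedDist x₀ v₀ r ρ t x v := by
  unfold transportedDist
  positivity

theorem continuous_transportedDist (x₀ v₀ : R3) (r ρ : ℝ) :
    Continuous fun q : ℝ × R3 × R3 => transportedDist x₀ v₀ r ρ q.1 q.2.1 q.2.2 := by
  unfold transportedDist
  fun_prop

/-- The barrier is quadratic in `v`; this is the parallelogram law for both squared norms. -/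
theorem barrier_second_difference (x₀ v₀ : R3) (r ρ δ l t : ℝ) (x v h : R3) :
    barrier x₀ v₀ r ρ δ l t x (v + h) + barrier x₀ v₀ r ρ δ l t x (v - h) -
      2 * barrier x₀ v₀ r ρ δ l t x v =
      -2 * δ * (‖h‖ ^ 2 / ρ ^ 2 + t ^ 2 * ‖h‖ ^ 2 / r ^ 2) := by
  have para : ∀ a k : R3, ‖a + k‖ ^ 2 = 2 * ‖a‖ ^ 2 + 2 * ‖k‖ ^ 2 - ‖a - k‖ ^ 2 := fun a k => by
    rw [norm_add_sq_real, norm_sub_sq_real]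
    ring
  have e1 : v + h - v₀ = (v - v₀) + h := by abel
  have e2 : v - h - v₀ = (v - v₀) - h := by abel
  have e3 : x - x₀ - t • (v + h) = (x - x₀ - t • v) - t • h := by module
  have e4 : x - x₀ - t • (v - h) = (x - x₀ - t • v) + t • h := by module
  simp only [barrier, transportedDist]
  rw [e1, e2, e3, e4, para (v - v₀) h, para (x - x₀ - t • v) (t • h), norm_smul t h, mul_pow,
    Real.norm_eq_abs, sq_abs]
  ring

theorem hasDerivAt_barrier_time (x₀ v₀ : R3) (r ρ δ l t : ℝ) (x v : R3) :
    HasDerivAt (fun t' => barrier x₀ v₀ r ρ δ l t' x v)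
      (δ * (2 * inner ℝ (x - x₀ - t • v) v / r ^ 2 - l)) t := by
  have h1 : HasDerivAt (fun t' : ℝ => x - x₀ - t' • v) (-v) t := by
    simpa using ((hasDerivAt_id t).smul_const v).const_sub (x - x₀)
  have h2 := h1.norm_sq
  have h3 := (((h2.div_const (r ^ 2)).const_add (‖v - v₀‖ ^ 2 / ρ ^ 2)).const_sub 1).sub
    ((hasDerivAt_id t).const_mul l)
  have h4 := h3.const_mul δ
  refine h4.congr_deriv ?_
  rw [inner_neg_right]
  ring

/-- The derivative in direction `v` cancels the inner product term of the time derivative, leaving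
the transport derivative `-δ l`. -/
theorem hasFDerivAt_barrier_space (x₀ v₀ : R3) (r ρ δ l t : ℝ) (x v : R3) :
    ∃ L : R3 →L[ℝ] ℝ, HasFDerivAt (fun x' => barrier x₀ v₀ r ρ δ l t x' v) L x ∧
      L v = -(δ * (2 * inner ℝ (x - x₀ - t • v) v / r ^ 2)) := by
  have h1 : HasFDerivAt (fun x' : R3 => x' - x₀ - t • v) (ContinuousLinearMap.id ℝ R3) x :=
    ((hasFDerivAt_id x).sub_const x₀).sub_const _
  have h2 := ((((h1.norm_sq.mul_const (r ^ 2)⁻¹).const_add (‖v - v₀‖ ^ 2 / ρ ^ 2)).const_sub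
    1).sub_const (l * t)).const_mul δ
  refine ⟨_, h2, ?_⟩
  change δ * -((r ^ 2)⁻¹ * (2 • inner ℝ (x - x₀ - t • v) v)) = _
  rw [nsmul_eq_mul]
  push_cast
  ring

/-- Slopes to earlier times are nonpositive. A one-sided statement is required since the minimum may
occur at the final time. -/
theorem deriv_nonpos_of_isMinOn_left {G : ℝ → ℝ} {G' t : ℝ} (ht : 0 < t)
    (hG : HasDerivWithinAt G G' (Icc 0 t) t) (hmin : ∀ u ∈ Icc 0 t, G t ≤ G u) : G' ≤ 0 := by
  rw [hasDerivWithinAt_iff_tendsto_slope, Icc_sdiff_right] at hG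
  have : (𝓝[Ico 0 t] t).NeBot := by
    rw [nhdsWithin_Ico_eq_nhdsLT ht]
    infer_instance
  refine le_of_tendsto hG ?_
  filter_upwards [self_mem_nhdsWithin] with u hu
  rw [slope_def_field]
  exact div_nonpos_of_nonneg_of_nonpos (sub_nonneg.2 (hmin u ⟨hu.1, hu.2.le⟩))
    (sub_nonpos.2 hu.2.le)

/-! ### Comparison with the barrier. -/

section Barrier

variable {γ s : ℝ} {b : ℝ → ℝ} {T : ℝ} {f : ℝ → R3 → R3 → ℝ}

theorem IsClassicalSolution.differentiableAt_space (hf : IsClassicalSolution γ s b T f) {t : ℝ}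
    (ht : t ∈ Icc 0 T) (x v : R3) : DifferentiableAt ℝ (fun x' => f t x' v) x := by
  have h := (hf.contDiffOn_tx v).comp (s := univ) (g := fun p : ℝ × R3 => f p.1 p.2 v)
    (f := fun x' : R3 => (t, x')) (contDiff_const.prodMk contDiff_id).contDiffOn
    (fun x' _ => ⟨ht, mem_univ _⟩)
  exact (contDiffOn_univ.1 h).differentiable one_ne_zero x

theorem IsClassicalSolution.differentiableWithinAt_time (hf : IsClassicalSolution γ s b T f)
    {t : ℝ} (ht : t ∈ Icc 0 T) (x v : R3) :
    DifferentiableWithinAt ℝ (fun t' => f t' x v) (Icc 0 T) t := by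
  have h := (hf.contDiffOn_tx v).comp (s := Icc 0 T) (g := fun p : ℝ × R3 => f p.1 p.2 v)
    (f := fun t' : ℝ => (t', x)) (contDiff_id.prodMk contDiff_const).contDiffOn
    (fun t' ht' => ⟨ht', mem_univ _⟩)
  exact h.differentiableOn one_ne_zero t ht

/-- At a point where `f - barrier` attains its minimum over earlier times and all positions, the
transport derivative of `f` is at most that of the barrier. -/
theorem IsClassicalSolution.transport_le (hf : IsClassicalSolution γ s b T f)
    {x₀ v₀ : R3} {r ρ δ l : ℝ} {t : ℝ} (ht0 : 0 < t) (htT : t ≤ T) {x v : R3} {m : ℝ}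
    (heq : f t x v = barrier x₀ v₀ r ρ δ l t x v + m)
    (hge : ∀ t' ∈ Icc 0 t, ∀ x' v' : R3, barrier x₀ v₀ r ρ δ l t' x' v' + m ≤ f t' x' v') :
    derivWithin (fun t' => f t' x v) (Icc 0 T) t + fderiv ℝ (fun x' => f t x' v) x v ≤
      -(δ * l) := by
  have ht : t ∈ Icc 0 T := ⟨ht0.le, htT⟩
  obtain ⟨L, hL, hLv⟩ := hasFDerivAt_barrier_space x₀ v₀ r ρ δ l t x v
  have hx := (hf.differentiableAt_space ht x v).hasFDerivAt
  have hmin : IsLocalMin (fun x' => f t x' v - barrier x₀ v₀ r ρ δ l t x' v) x :=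
    Eventually.of_forall fun x' => by
      have := hge t ⟨ht0.le, le_rfl⟩ x' v
      linarith
  have hzero := hmin.hasFDerivAt_eq_zero (hx.sub hL)
  have hfx : fderiv ℝ (fun x' => f t x' v) x v = L v := by
    rw [sub_eq_zero.1 hzero]
  have htime := (hf.differentiableWithinAt_time ht x v).hasDerivWithinAt.mono
    (Icc_subset_Icc_right htT)
  have hdiff := htime.sub (hasDerivAt_barrier_time x₀ v₀ r ρ δ l t x v).hasDerivWithinAt
  have := deriv_nonpos_of_isMinOn_left ht0 hdiff fun u hu => by
    have := hge u hu x v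
    simp only [Pi.sub_apply]
    linarith
  rw [hfx, hLv]
  linarith

/-- If the transport derivative of `f` exceeds `-δ l` wherever `f` touches a translate of the
barrier from above, then `f` stays above the barrier. -/
theorem IsClassicalSolution.barrier_le (hf : IsClassicalSolution γ s b T f)
    {x₀ v₀ : R3} {r ρ δ l S : ℝ} (hr : 0 < r) (hρ : 0 < ρ) (hδ : 0 < δ) (hl : 0 ≤ l) (hST : S ≤ T)
    (hinit : ∀ x v : R3, ‖x - x₀‖ < r → ‖v - v₀‖ < ρ → δ ≤ f 0 x v)
    (htouch : ∀ t ∈ Icc 0 S, ∀ (x v : R3) (m : ℝ), ‖v - v₀‖ ≤ ρ → m < 0 →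
      f t x v = barrier x₀ v₀ r ρ δ l t x v + m →
      (∀ v', barrier x₀ v₀ r ρ δ l t x v' + m ≤ f t x v') →
      -(δ * l) < derivWithin (fun t' => f t' x v) (Icc 0 T) t + fderiv ℝ (fun x' => f t x' v) x v)
    {t : ℝ} (ht : t ∈ Icc 0 S) (x v : R3) : barrier x₀ v₀ r ρ δ l t x v ≤ f t x v := by
  by_contra! hcon
  set E : ℝ × R3 × R3 → ℝ := fun q => transportedDist x₀ v₀ r ρ q.1 q.2.1 q.2.2 with hE
  have hEc : Continuous E := continuous_transportedDist x₀ v₀ r ρ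
  set D : Set (ℝ × R3 × R3) := (Icc 0 S ×ˢ univ) ∩ {q | E q ≤ 1} with hD
  have hvel : ∀ q, E q ≤ 1 → ‖q.2.2 - v₀‖ ≤ ρ ∧ ‖q.2.1 - x₀ - q.1 • q.2.2‖ ≤ r := by
    intro q hq
    simp only [hE, transportedDist] at hq
    have h1 : 0 ≤ ‖q.2.2 - v₀‖ ^ 2 / ρ ^ 2 := by positivity
    have h2 : 0 ≤ ‖q.2.1 - x₀ - q.1 • q.2.2‖ ^ 2 / r ^ 2 := by positivity
    constructor
    · have : ‖q.2.2 - v₀‖ ^ 2 / ρ ^ 2 ≤ 1 := by linarith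
      rw [div_le_one (by positivity)] at this
      exact le_of_sq_le_sq this hρ.le
    · have : ‖q.2.1 - x₀ - q.1 • q.2.2‖ ^ 2 / r ^ 2 ≤ 1 := by linarith
      rw [div_le_one (by positivity)] at this
      exact le_of_sq_le_sq this hr.le
  have hDcompact : IsCompact D := by
    refine IsCompact.of_isClosed_subset ((isCompact_Icc (a := 0) (b := S)).prod
      ((isCompact_closedBall x₀ (r + S * (‖v₀‖ + ρ))).prod (isCompact_closedBall v₀ ρ)))
      ((isClosed_Icc.prod isClosed_univ).inter (isClosed_le hEc continuous_const)) ?_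
    rintro ⟨t', x', v'⟩ ⟨⟨ht', -⟩, hq⟩
    obtain ⟨h1, h2⟩ := hvel _ hq
    simp only at h1 h2 ht'
    refine ⟨ht', ?_, ?_⟩
    · rw [mem_closedBall_iff_norm]
      have h3 : ‖v'‖ ≤ ‖v₀‖ + ρ := by
        have := norm_add_le (v' - v₀) v₀
        rw [sub_add_cancel] at this
        linarith
      have h4 : ‖t' • v'‖ ≤ S * (‖v₀‖ + ρ) := by
        rw [norm_smul, Real.norm_of_nonneg ht'.1]
        exact mul_le_mul ht'.2 h3 (norm_nonneg _) (ht'.1.trans ht'.2)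
      have := norm_add_le (x' - x₀ - t' • v') (t' • v')
      rw [sub_add_cancel] at this
      linarith
    · rw [mem_closedBall_iff_norm]
      exact h1
  set Φ : ℝ × R3 × R3 → ℝ := fun q => f q.1 q.2.1 q.2.2 - barrier x₀ v₀ r ρ δ l q.1 q.2.1 q.2.2
    with hΦ
  have hΦc : ContinuousOn Φ D := by
    refine ContinuousOn.sub (hf.continuousOn.mono ?_) ?_
    · rintro q ⟨⟨h, -⟩, -⟩
      exact ⟨⟨h.1, h.2.trans hST⟩, mem_univ _⟩
    · have : Continuous fun q : ℝ × R3 × R3 => δ * (1 - E q - l * q.1) := by fun_prop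
      exact this.continuousOn
  have hout : ∀ t' ∈ Icc 0 S, ∀ x' v' : R3, 1 ≤ E (t', x', v') →
      barrier x₀ v₀ r ρ δ l t' x' v' ≤ 0 := by
    intro t' ht' x' v' hE1
    simp only [hE] at hE1
    exact mul_nonpos_of_nonneg_of_nonpos hδ.le (by linarith [mul_nonneg hl ht'.1])
  have hfnn : ∀ t' ∈ Icc 0 S, ∀ x' v' : R3, 0 ≤ f t' x' v' := fun t' ht' =>
    hf.nonneg t' ⟨ht'.1, ht'.2.trans hST⟩
  have hmem : (t, x, v) ∈ D := by
    refine ⟨⟨ht, mem_univ _⟩, ?_⟩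
    by_contra hE1
    have := hout t ht x v (not_le.1 hE1).le
    linarith [hfnn t ht x v]
  obtain ⟨⟨t₁, x₁, v₁⟩, hq₁, hmin⟩ := hDcompact.exists_isMinOn ⟨_, hmem⟩ hΦc
  have ht₁ : t₁ ∈ Icc 0 S := hq₁.1.1
  set m : ℝ := Φ (t₁, x₁, v₁) with hm
  have hm0 : m < 0 := by
    refine (hmin hmem).trans_lt ?_
    simp only [hΦ]
    linarith
  have heq : f t₁ x₁ v₁ = barrier x₀ v₀ r ρ δ l t₁ x₁ v₁ + m := by
    simp only [hm, hΦ]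
    ring
  -- The minimum over `D` is global: outside `D` the barrier is nonpositive, `m` is negative and `f`
  -- is nonnegative.
  have hge : ∀ t' ∈ Icc 0 S, ∀ x' v' : R3, barrier x₀ v₀ r ρ δ l t' x' v' + m ≤ f t' x' v' := by
    intro t' ht' x' v'
    by_cases hE1 : E (t', x', v') ≤ 1
    · have : m ≤ Φ (t', x', v') := hmin ⟨⟨ht', mem_univ _⟩, hE1⟩
      simp only [hΦ] at this
      linarith
    · have := hout t' ht' x' v' (not_le.1 hE1).le
      linarith [hfnn t' ht' x' v']
  -- At time zero a negative minimum is impossible: where `E < 1` the initial bound gives `f ≥ δ ≥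
  -- barrier`, elsewhere the barrier is nonpositive.
  have hpos : 0 < t₁ := by
    rcases ht₁.1.eq_or_lt with h0 | h0
    · exfalso
      subst h0
      rcases lt_or_ge (E (0, x₁, v₁)) 1 with hE1 | hE1
      · have hE0 := transportedDist_nonneg x₀ v₀ r ρ 0 x₁ v₁
        simp only [hE] at hE1
        have hb : barrier x₀ v₀ r ρ δ l 0 x₁ v₁ ≤ δ := by
          refine mul_le_of_le_one_right hδ.le ?_
          linarith
        simp only [transportedDist, zero_smul, sub_zero] at hE1
        have h1 : 0 ≤ ‖v₁ - v₀‖ ^ 2 / ρ ^ 2 := by positivity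
        have h2 : 0 ≤ ‖x₁ - x₀‖ ^ 2 / r ^ 2 := by positivity
        have h3 : ‖v₁ - v₀‖ ^ 2 / ρ ^ 2 < 1 := by linarith
        have h4 : ‖x₁ - x₀‖ ^ 2 / r ^ 2 < 1 := by linarith
        rw [div_lt_one (by positivity)] at h3 h4
        have := hinit x₁ v₁ (lt_of_pow_lt_pow_left₀ 2 hr.le h4)
          (lt_of_pow_lt_pow_left₀ 2 hρ.le h3)
        linarith
      · have := hout 0 ht₁ x₁ v₁ hE1
        linarith [hfnn 0 ht₁ x₁ v₁]
    · exact h0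
  have h1 := htouch t₁ ht₁ x₁ v₁ m (hvel _ hq₁.2).1 hm0 heq (hge t₁ ht₁ x₁)
  have h2 := hf.transport_le hpos (ht₁.2.trans hST) heq
    (fun t' ht' => hge t' ⟨ht'.1, ht'.2.trans ht₁.2⟩)
  linarith

end Barrier

/-! ### Choice of constants and conclusion. -/

theorem one_add_le_two_mul_bracket (a : ℝ) : 1 + a ≤ 2 * bracket a := by
  have h1 : 1 ≤ bracket a := Real.one_le_sqrt.2 (by nlinarith [sq_nonneg |a|])
  have h2 : a ≤ bracket a := Real.le_sqrt_of_sq_le (by rw [sq_abs]; linarith)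
  linarith

theorem lemma3p1 (γ s : ℝ) (hγ : -3 < γ) (hs₀ : 0 < s) (hs₁ : s < 1)
    (b : ℝ → ℝ) (hb : IsAngularFunction b) (K₀ : ℝ) (p : ENNReal) (P₀ : ℝ)
    (hp : γ + 2 * s < 0 → ENNReal.ofReal (3 / (3 + γ + 2 * s)) < p) :
    ∃ C : ℝ, 0 < C ∧
      ∀ (T : ℝ), 0 < T → ∀ (τ : ℝ), 0 < τ → ∀ (f : ℝ → R3 → R3 → ℝ),
        IsClassicalSolution γ s b T f → HydroBounds γ s K₀ p P₀ T f →
        ∀ (x₀ v₀ : R3) (δ r : ℝ), 0 < δ → 0 < r →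
          (∀ x v : R3, ‖x - x₀‖ < r → ‖v - v₀‖ < r / τ → δ ≤ f 0 x v) →
          ∀ (t : ℝ) (x v : R3), 0 ≤ t → t ≤ min T τ →
            ‖v - v₀‖ ^ 2 / (r ^ 2 / τ ^ 2) + ‖x - x₀ - t • v‖ ^ 2 / r ^ 2 < 1 / 4 →
            t < C * r ^ (2 * s) /
              (τ ^ (2 * s) * bracket (‖v₀‖ + r / τ) ^ max (γ + 2 * s) 0) →
            δ / 2 ≤ f t x v := by
  obtain ⟨M, hM⟩ := hb.bounded
  have hM0 : 0 < M := (hb.pos 0 (by norm_num)).trans_le (hM 0 (by norm_num))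
  obtain ⟨CI, hCI, hconv⟩ := exists_lintegral_rpow_mul_le (a := γ + 2 * s) (by linarith) K₀ p P₀
    (by rwa [← add_assoc])
  set e := max (γ + 2 * s) 0 with he
  have he0 : 0 ≤ e := le_max_right _ _
  have hC1 : 0 < singularConstant γ s M := by
    have := maxJacobian_pos γ
    have : 0 < 2 - 2 * s := by linarith
    unfold singularConstant
    positivity
  -- The leading `2` gives the strict inequality at touching points, `2^s` comes from `B = 2/ρ²`,
  -- and `2^e` from `1 + |v| ≤ 2 ⟨|v₀| + ρ⟩`.
  set A := 2 * singularConstant γ s M * 2 ^ s * (CI * 2 ^ e) with hA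
  have hApos : 0 < A := by positivity
  -- With this constant `l t < 1/4`; together with a transported distance below `1/4` the barrier
  -- exceeds `δ/2`.
  refine ⟨1 / (4 * A), by positivity, ?_⟩
  intro T hT τ hτ f hf hh x₀ v₀ δ r hδ hr hinit t x v ht0 htle hE ht
  set ρ := r / τ with hρ
  have hρ0 : 0 < ρ := by positivity
  set β := bracket (‖v₀‖ + ρ) with hβ
  have hβ0 : 0 < β := Real.sqrt_pos.2 (by positivity)
  set l := A * (ρ ^ (2 * s))⁻¹ * β ^ e with hl
  have hl0 : 0 < l := by positivity
  have hbar := hf.barrier_le (x₀ := x₀) (v₀ := v₀) (r := r) (ρ := ρ) (δ := δ) (l := l)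
    (S := min T τ) hr hρ0 hδ hl0.le (min_le_left _ _) hinit ?_ ⟨ht0, htle⟩ x v
  · have hlt : l * t < 1 / 4 := by
      calc l * t < l * (1 / (4 * A) * r ^ (2 * s) / (τ ^ (2 * s) * β ^ e)) := by gcongr
        _ = 1 / 4 := by
          rw [hl, hρ, Real.div_rpow hr.le hτ.le]
          have := (Real.rpow_pos_of_pos hr (2 * s)).ne'
          have := (Real.rpow_pos_of_pos hτ (2 * s)).ne'
          have := (Real.rpow_pos_of_pos hβ0 e).ne'
          field_simp
    rw [← div_pow, ← hρ] at hE
    refine le_trans ?_ hbar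
    unfold barrier transportedDist
    nlinarith
  · intro t' ht' x' v' m hv' hm heq hge
    have htT : t' ∈ Icc 0 T := ⟨ht'.1, ht'.2.trans (min_le_left _ _)⟩
    have htτ : t' ≤ τ := ht'.2.trans (min_le_right _ _)
    have hgc : Continuous (f t' x') := (hf.contDiff_v t' htT x').continuous
    have hg0 : ∀ w, 0 ≤ f t' x' w := hf.nonneg t' htT x'
    have hint := hh.integrable t' htT x'
    have hL := lintegral_rpow_mul_ne_top (a := γ) hγ
      (le_trans (by linarith) (le_max_right 2 (γ + 2 * s))) hgc hg0 hint v'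
    have hI := hconv (f t' x') hgc hg0 hint (hh.moment_le t' htT x')
      (fun h => hh.eLpNorm_le h t' htT x') v'
    -- This uses `m < 0`, and gives the bound on second differences for large `h`.
    have hgδ : f t' x' v' ≤ δ := by
      have : barrier x₀ v₀ r ρ δ l t' x' v' ≤ δ := by
        refine mul_le_of_le_one_right hδ.le ?_
        linarith [transportedDist_nonneg x₀ v₀ r ρ t' x' v', mul_nonneg hl0.le ht'.1]
      linarith
    have hsec : ∀ h : R3, -2 * δ * min (2 / ρ ^ 2 * ‖h‖ ^ 2) 1 ≤
        f t' x' (v' + h) + f t' x' (v' - h) - 2 * f t' x' v' := by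
      intro h
      rcases le_total (2 / ρ ^ 2 * ‖h‖ ^ 2) 1 with hh1 | hh1
      · rw [min_eq_left hh1]
        have h1 := hge (v' + h)
        have h2 := hge (v' - h)
        have h3 := barrier_second_difference x₀ v₀ r ρ δ l t' x' v' h
        -- Here `t ≤ τ` enters: the position term of the barrier is no more curved in `v` than the
        -- velocity term, hence `B = 2/ρ²`.
        have h4 : t' ^ 2 * ‖h‖ ^ 2 / r ^ 2 ≤ ‖h‖ ^ 2 / ρ ^ 2 := by
          rw [hρ, div_pow, div_div_eq_mul_div, mul_comm (‖h‖ ^ 2)]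
          gcongr
          exact ht'.1
        have h5 : 2 / ρ ^ 2 * ‖h‖ ^ 2 = ‖h‖ ^ 2 / ρ ^ 2 + ‖h‖ ^ 2 / ρ ^ 2 := by ring
        have h6 := mul_le_mul_of_nonneg_left h4 hδ.le
        rw [h5]
        linarith
      · rw [min_eq_right hh1]
        linarith [hg0 (v' + h), hg0 (v' - h)]
    have hQ := collision_ge hγ hs₀ hs₁ hb hM hgc.measurable hg0 hL (B := 2 / ρ ^ 2)
      (by positivity) hδ.le (by positivity) hI hsec (hf.equation t' htT x' v')
    refine lt_of_lt_of_le ?_ hQ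
    rw [neg_lt_neg_iff]
    refine mul_lt_mul_of_pos_left ?_ hδ
    have hvn : 1 + ‖v'‖ ≤ 2 * β := by
      have h1 := norm_add_le (v' - v₀) v₀
      rw [sub_add_cancel] at h1
      have h2 := one_add_le_two_mul_bracket (‖v₀‖ + ρ)
      linarith
    have hB : (2 / ρ ^ 2) ^ s = 2 ^ s * (ρ ^ (2 * s))⁻¹ := by
      rw [Real.div_rpow (by norm_num) (by positivity), ← Real.rpow_natCast,
        ← Real.rpow_mul hρ0.le]
      push_cast
      ring
    calc singularConstant γ s M * (2 / ρ ^ 2) ^ s * (CI * (1 + ‖v'‖) ^ e)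
        ≤ singularConstant γ s M * (2 / ρ ^ 2) ^ s * (CI * (2 * β) ^ e) := by gcongr
      _ = l / 2 := by
        rw [hB, Real.mul_rpow (by norm_num) hβ0.le, hl, hA]
        ring
      _ < l := by linarith
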